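/- **Proposition 1 (Generating a summary graph by operating on at most two nodes).** *Definitions.* All graphs are finite. A *summary graph* $G$ has a node set $N$ that is the disjoint union of two sets $u,v$, ordered as $(u,v)$. Within $u$ it has arrows $i\leftarrow k$ and dashed lines $i\,\text{- -}\,k$; within $v$ it has full lines $i — k$; between $u$ and $v$ it has only arrows pointing from $v$ to $u$; and it has no directed cycle. A pair may be coupled by both an arrow and a dashed line. A node $k$ is an *ancestor* of $i$ (and $i$ a *descendant* of $k$) if there is a directed path with at least one arrow from $k$ to $i$. The inner node of a two-edge path is a *collision node* in $\circ\to\circ\leftarrow\circ$, $\circ\to\circ\,\text{- -}\,\circ$ and $\circ\,\text{- -}\,\circ\,\text{- -}\,\circ$ and a *transmitting node* otherwise. For disjoint $\alpha,\beta,c\subseteq N$, $G$ *implies* $\alpha\perp\!\!\!\perp\beta\mid c$ if there is no path (with distinct inner nodes) between a node of $\alpha$ and a node of $\beta$ on which every inner collision node is in $c$ or has a descendant in $c$ and every other inner node is outside $c$. *Summary graph of a directed acyclic graph.* Let $D$ be a directed acyclic graph with node set $V$ and let $C,M\subseteq V$ be disjoint. Let $\mathcal A$ be its edge matrix ($\mathcal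 A_{ik}=1$ if $i=k$ or $i\leftarrow k$, and $0$ otherwise), $F$ the set of ancestors of $C$ outside $C$, $R=C\cup F$, $O=V\setminus R$, $p=O\cap M$, $q=F\cap M$, $u=O\setminus M$, $v=F\setminus M$. For a binary matrix $\mathcal F$ with unit diagonal and a node set $a$ with complement $b$, let $\mathcal F_{aa}^-$ be the reflexive–transitive closure of $\mathcal F_{aa}$ and let $$\operatorname{zer}_a\mathcal F=\operatorname{In}\begin{pmatrix}\mathcal F_{aa}^-&\mathcal F_{aa}^-\mathcal F_{ab}\\ \mathcal F_{ba}\mathcal F_{aa}^-&\mathcal F_{bb}+\mathcal F_{ba}\mathcal F_{aa}^-\mathcal F_{ab}\end{pmatrix},$$ where $\operatorname{In}$ replaces each nonzero entry by $1$. Put $\mathcal D=\operatorname{zer}_p\mathcal A$ and let $\mathcal S=\operatorname{In}[\mathcal A_{RR}^{\mathrm T}\mathcal A_{RR}]_{F,F}$ and $\mathcal T=\operatorname{zer}_q\mathcal S$. Then $G^{V\setminus[C,M]}_{\rm sum}$ is the graph with node set $(u,v)$ whose arrows within $u$ are given by $\mathcal D_{uu}$, arrows from $v$ to $u$ by $\operatorname{In}[\mathcal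 D_{uv}+\mathcal D_{uq}\mathcal T_{qv}]$, dashed lines by $\operatorname{In}[\mathcal I_{uu}+\mathcal D_{up}\mathcal D_{up}^{\mathrm T}+\mathcal D_{uq}\mathcal T_{qq}\mathcal D_{uq}^{\mathrm T}]$ and full lines by $\mathcal T_{vv}$ (off-diagonal entries). *Procedure.* Let $G$ be a summary graph with node set $N=(u,v)$ and let $s\ne t$ be nodes of $N$, $s$ to be conditioned on and $t$ to be marginalised over; one or both may be absent. Let $d_s$ be the set of ancestors of $s$ within $u$ (empty if $s$ is absent), $v'=(v\cup d_s)\setminus\{s,t\}$ and $u'=N\setminus(\{s,t\}\cup v')$. 1. First, for all pairs $i\ne k$ of neighbors of $t$, add the edge induced by marginalising over $t$: - $i\leftarrow t\to k$ and $i\leftarrow t\,\text{- -}\,k$ each induce $i\,\text{- -}\,k$; - $i\leftarrow t — k$, $i\leftarrow t\leftarrow k$ and $i\,\text{- -}\,t — k$ each induce $i\leftarrow k$; - $i — t — k$ and $i — t\leftarrow k$ each induce $i — k$. Second, ignoring edges that involve $t$, for $a=s$ and for every ancestor $a\neq t$ of $s$ in $G$, taken one at a time in any order in the graph obtained so far,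 add for all pairs $i\ne k$ of neighbors of $a$ the induced edge: - $i\to a\leftarrow k$ induces $i — k$; - $i\to a\,\text{- -}\,k$ induces $i\to k$; - $i\,\text{- -}\,a\,\text{- -}\,k$ induces $i\,\text{- -}\,k$. 2. Change each edge within $v'$ into a full line and each edge between $u'$ and $v'$ into an arrow pointing from $v'$ to $u'$. 3. Of several edges of the same kind for a node pair keep just one, and delete $s$, $t$ and all edges involving them. *Statement.* Let $G$ be a summary graph with node set $N$. (a) For $s,t$ as above, the procedure yields one and the same graph $G'$ for every order of the ancestors of $s$, and $G'$ is the independence-preserving summary graph $G^{N\setminus[s,t]}_{\rm sum}$. That is: $G'$ is a summary graph with node set $N\setminus\{s,t\}=(u',v')$; for all disjoint $\alpha,\beta,c\subseteq N\setminus\{s,t\}$, $G'$ implies $\alpha\perp\!\!\!\perp\beta\mid c$ if and only if $G$ implies $\alpha\perp\!\!\!\perp\beta\mid c\cup\{s\}$; and whenever $G=G^{V\setminus[C,M]}_{\rm sum}$ for a directed acyclic graph $D$ with node set $V$ and disjoint $C,M\subseteq V$, then $G'=G^{V\setminus[C\cup\{s\},\,M\cup\{t\}]}_{\rm sum}$,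 and $G'$ implies $\alpha\perp\!\!\!\perp\beta\mid c$ if and only if $D$ implies $\alpha\perp\!\!\!\perp\beta\mid c\cup C\cup\{s\}$. (b) The order of the operations does not matter. The same graph $G'$ results if in step 1 one works first on $s$ and all of its ancestors (including $t$, if it is one) and then on $t$, ignoring edges that involve $s$; or if one first applies the whole procedure to $t$ only and then to $s$ only; or first to $s$ only and then to $t$ only. More generally, let $c,m\subseteq N$ be disjoint. Conditioning on the nodes of $c$ and marginalising over the nodes of $m$, one node at a time with the whole procedure, yields one and the same graph for every order of these operations, and this graph is the independence-preserving summary graph $G^{N\setminus[c,m]}_{\rm sum}$, in the sense of (a) with $c,m$ in place of $\{s\},\{t\}$; in particular, its $v$-part consists of the nodes of $v$ and the ancestors of $c$ within $u$, without the nodes in $c\cup m$. -/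

import Mathlib

/-- A graph whose nodes (a subset of `V`) are split into two ordered parts `(u, v)` and which has
three kinds of edge: `arrow i k` is the arrow `i ← k` (from `k` to `i`), `dashed i k` the dashed
line between `i` and `k`, `full i k` the full line between `i` and `k`. Edges of the same kind
between the same nodes are not counted twice. -/
@[ext]
structure MixedGraph (V : Type*) where
  u : Set V
  v : Set V
  arrow : V → V → Prop
  dashed : V → V → Prop
  full : V → V → Prop

namespace MixedGraph

variable {V : Type*}

/-- The node set `N`. -/
def nodes (G : MixedGraph V) : Set V := G.u ∪ G.v

/-- `k` is an ancestor of `i` (and `i` a descendant of `k`): there is a directed path with at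
least one arrow from `k` to `i`. -/
def IsAncestor (G : MixedGraph V) (k i : V) : Prop :=
  Relation.TransGen (fun x y => G.arrow y x) k i

/-- The ancestors of the nodes in `S`. -/
def ancestors (G : MixedGraph V) (S : Set V) : Set V := {k | ∃ s ∈ S, G.IsAncestor k s}

/-- The two nodes are coupled by an edge of some kind and direction. -/
def Coupled (G : MixedGraph V) (i k : V) : Prop :=
  G.arrow i k ∨ G.arrow k i ∨ G.dashed i k ∨ G.full i k

/-- Summary graph: within `u` a mixture of a directed acyclic graph and a covariance graph (dashed
lines), within `v` a concentration graph (full lines), between `u` and `v` only arrows pointing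
from `v` to `u`. -/
structure IsSummaryGraph (G : MixedGraph V) : Prop where
  disjoint : Disjoint G.u G.v
  arrow_mem : ∀ i k, G.arrow i k → i ∈ G.u ∧ k ∈ G.nodes
  acyclic : ∀ i, ¬ G.IsAncestor i i
  dashed_mem : ∀ i k, G.dashed i k → i ∈ G.u ∧ k ∈ G.u ∧ i ≠ k
  dashed_symm : ∀ i k, G.dashed i k → G.dashed k i
  full_mem : ∀ i k, G.full i k → i ∈ G.v ∧ k ∈ G.v ∧ i ≠ k
  full_symm : ∀ i k, G.full i k → G.full k i

/-- Directed acyclic graph: a summary graph with arrows only and with empty `v`. -/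
structure IsDAG (G : MixedGraph V) : Prop where
  isSummaryGraph : G.IsSummaryGraph
  v_empty : G.v = ∅
  no_dashed : ∀ i k, ¬ G.dashed i k
  no_full : ∀ i k, ¬ G.full i k

/-! ### Paths and the independence structure -/

/-- The four ways in which an edge can join `x` (on the left) and `y` (on the right):
`x ← y`, `x → y`, dashed, full. -/
inductive EdgeType
  | left
  | right
  | dashed
  | full

/-- `x` and `y` are joined by an edge of the given type. -/
def HasEdge (G : MixedGraph V) : EdgeType → V → V → Prop
  | .left, x, y => G.arrow x y
  | .right, x, y => G.arrow y x
  | .dashed, x, y => G.dashed x y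
  | .full, x, y => G.full x y

/-- The inner node of a two-edge path is a collision node for
`∘ → ∘ ← ∘`, `∘ → ∘ - - ∘`, `∘ - - ∘ ← ∘` and `∘ - - ∘ - - ∘`; otherwise it is transmitting. -/
def IsCollision (e₁ e₂ : EdgeType) : Prop :=
  (e₁ = .right ∨ e₁ = .dashed) ∧ (e₂ = .left ∨ e₂ = .dashed)

/-- The nodes `x 0, …, x n` and edges `e 0, …, e (n - 1)` form a path with distinct inner nodes
on which every inner collision node is in `c` or has a descendant in `c`, and every other inner
node is outside `c`. -/
structure IsActivePath (G : MixedGraph V) (c : Set V) (n : ℕ) (x : ℕ → V) (e : ℕ → EdgeType) :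
    Prop where
  pos : 0 < n
  edge : ∀ j, j < n → G.HasEdge (e j) (x j) (x (j + 1))
  inner_distinct : Set.InjOn x (Set.Ioo 0 n)
  collision : ∀ j, j + 1 < n → IsCollision (e j) (e (j + 1)) →
    x (j + 1) ∈ c ∨ ∃ d ∈ c, G.IsAncestor (x (j + 1)) d
  transmitting : ∀ j, j + 1 < n → ¬ IsCollision (e j) (e (j + 1)) → x (j + 1) ∉ c

/-- The graph implies that `α` is independent of `β` given `c`. -/
def Implies (G : MixedGraph V) (α β c : Set V) : Prop :=
  ¬ ∃ i ∈ α, ∃ k ∈ β, ∃ n x e, G.IsActivePath c n x e ∧ x 0 = i ∧ x n = k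

/-- The independence statements of `G'` are those of `G` that concern only the nodes of `G'` (the
other nodes outside `S` being marginalised over) and that are given `S`. -/
def PreservesIndependence (G : MixedGraph V) (S : Set V) (G' : MixedGraph V) : Prop :=
  ∀ α β c : Set V, α ⊆ G'.nodes → β ⊆ G'.nodes → c ⊆ G'.nodes →
    Disjoint α β → Disjoint α c → Disjoint β c →
    (G'.Implies α β c ↔ G.Implies α β (c ∪ S))

/-! ### The construction by inducing, re-typing and deleting edges -/

/-- Add the edges induced by marginalising over a common neighbor `t ∈ T`, ignoring edges that
involve nodes in `X`. -/
def margStep (X T : Set V) (G : MixedGraph V) : MixedGraph V where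
  u := G.u
  v := G.v
  -- `i ← t — k`, `i ← t ← k` and `i - - t — k` induce `i ← k`
  arrow i k := G.arrow i k ∨ (i ≠ k ∧ i ∉ X ∧ k ∉ X ∧ ∃ t ∈ T, t ∉ X ∧
    ((G.arrow i t ∧ G.full t k) ∨ (G.arrow i t ∧ G.arrow t k) ∨ (G.dashed i t ∧ G.full t k)))
  -- `i ← t → k`, `i ← t - - k` and `i - - t → k` induce `i - - k`
  dashed i k := G.dashed i k ∨ (i ≠ k ∧ i ∉ X ∧ k ∉ X ∧ ∃ t ∈ T, t ∉ X ∧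
    ((G.arrow i t ∧ G.arrow k t) ∨ (G.arrow i t ∧ G.dashed t k) ∨ (G.dashed i t ∧ G.arrow k t)))
  -- `i — t — k`, `i — t ← k` and `i → t — k` induce `i — k`
  full i k := G.full i k ∨ (i ≠ k ∧ i ∉ X ∧ k ∉ X ∧ ∃ t ∈ T, t ∉ X ∧
    ((G.full i t ∧ G.full t k) ∨ (G.full i t ∧ G.arrow t k) ∨ (G.arrow t i ∧ G.full t k)))

/-- Add the edges induced around the common neighbor `a` when `a` or one of its descendants is
conditioned on, ignoring edges that involve nodes in `X`. -/
def condStep (X : Set V) (G : MixedGraph V) (a : V) : MixedGraph V where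
  u := G.u
  v := G.v
  -- `i - - a ← k` induces `i ← k`
  arrow i k := G.arrow i k ∨ (i ≠ k ∧ i ∉ X ∧ k ∉ X ∧ a ∉ X ∧ G.dashed i a ∧ G.arrow a k)
  -- `i - - a - - k` induces `i - - k`
  dashed i k := G.dashed i k ∨ (i ≠ k ∧ i ∉ X ∧ k ∉ X ∧ a ∉ X ∧ G.dashed i a ∧ G.dashed a k)
  -- `i → a ← k` induces `i — k`
  full i k := G.full i k ∨ (i ≠ k ∧ i ∉ X ∧ k ∉ X ∧ a ∉ X ∧ G.arrow a i ∧ G.arrow a k)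

/-- Apply `condStep` successively to the nodes of a list. -/
def condSteps (X : Set V) (G : MixedGraph V) (L : List V) : MixedGraph V :=
  L.foldl (condStep X) G

/-- Change each edge within `v'` into a full line and each edge between `u'` and `v'` into an arrow
pointing from `v'` to `u'`, and delete all nodes and edges outside `u' ∪ v'`. -/
def retype (u' v' : Set V) (G : MixedGraph V) : MixedGraph V where
  u := u'
  v := v'
  arrow i k := (i ∈ u' ∧ k ∈ u' ∧ G.arrow i k) ∨ (i ∈ u' ∧ k ∈ v' ∧ G.Coupled i k)
  dashed i k := i ∈ u' ∧ k ∈ u' ∧ G.dashed i k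
  full i k := (i ∈ u' ∧ k ∈ u' ∧ G.full i k) ∨ (i ∈ v' ∧ k ∈ v' ∧ G.Coupled i k)

/-- The new set `v'`: the nodes of `v` and the ancestors within `u` of the conditioning nodes `S`,
without the nodes in `S` and in the marginalising set `T`. -/
def newV (G : MixedGraph V) (S T : Set V) : Set V :=
  (G.v ∪ (G.ancestors S ∩ G.u)) \ (S ∪ T)

/-- The new set `u'`: the remaining nodes. -/
def newU (G : MixedGraph V) (S T : Set V) : Set V :=
  G.nodes \ (S ∪ T ∪ G.newV S T)

/-- `H` is a result of the three-step procedure on `G` with conditioning nodes `S` and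
marginalising nodes `T` (each at most one): edges are induced first around the node of `T`,
then, ignoring edges that involve `T`, around the node of `S` and all of its
ancestors, taken one at a time in some order; then edges are re-typed and `S`, `T` deleted. -/
def Generates (G : MixedGraph V) (S T : Set V) (H : MixedGraph V) : Prop :=
  ∃ L : List V, (∀ a, a ∈ L ↔ a ∈ (S ∪ G.ancestors S) \ T) ∧
    H = retype (G.newU S T) (G.newV S T) (condSteps T (margStep ∅ T G) L)

/-- The same with the order within the first step reversed: first around the node of `S` and all
of its ancestors, then, ignoring edges that involve `S`, around the node of `T`. -/
def GeneratesCondFirst (G : MixedGraph V) (S T : Set V) (H : MixedGraph V) : Prop :=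
  ∃ L : List V, (∀ a, a ∈ L ↔ a ∈ S ∪ G.ancestors S) ∧
    H = retype (G.newU S T) (G.newV S T) (margStep S T (condSteps ∅ G L))

/-- An operation on a single node. -/
inductive Op (V : Type*)
  | condition (s : V)
  | marginalise (t : V)

/-- The node operated on. -/
def Op.node : Op V → V
  | .condition s => s
  | .marginalise t => t

/-- The nodes conditioned on in a list of operations. -/
def condSet (ops : List (Op V)) : Set V := {s | Op.condition s ∈ ops}

/-- The nodes marginalised over in a list of operations. -/
def margSet (ops : List (Op V)) : Set V := {t | Op.marginalise t ∈ ops}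

/-- `H` results from `G` by carrying out the single-node operations of the list one after the
other, each time with the full three-step procedure. -/
inductive GeneratesList : MixedGraph V → List (Op V) → MixedGraph V → Prop
  | nil (G : MixedGraph V) : GeneratesList G [] G
  | condition {G K H : MixedGraph V} {s : V} {ops : List (Op V)} :
      G.Generates {s} ∅ K → GeneratesList K ops H → GeneratesList G (.condition s :: ops) H
  | marginalise {G K H : MixedGraph V} {t : V} {ops : List (Op V)} :
      G.Generates ∅ {t} K → GeneratesList K ops H → GeneratesList G (.marginalise t :: ops) H

/-! ### The summary graph of a directed acyclic graph

Binary edge matrices are relations: sums of binary matrices (after the indicator function) are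
disjunctions, products are compositions. Edge matrices have ones along the diagonal. -/

/-- The block `F_aa⁻`: its ones are the pairs in `a` that are equal or connected by a path of
ones of `F` within `a`. (For binary `F` with `d` nodes in `a`, these are the nonzero entries of
the nonnegative matrix `((d + 1) I - F_aa)⁻¹`.) -/
def closure (a : Set V) (F : V → V → Prop) (i k : V) : Prop :=
  i ∈ a ∧ k ∈ a ∧ Relation.ReflTransGen (fun x y => x ∈ a ∧ y ∈ a ∧ F x y) i k

/-- Partial closure `zer_a F`, with blocks `F_aa⁻`, `F_aa⁻ F_ab`, `F_ba F_aa⁻` and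
`F_bb + F_ba F_aa⁻ F_ab`, where `b` is the complement of `a`. -/
def zer (a : Set V) (F : V → V → Prop) (i k : V) : Prop :=
  (i ∈ a ∧ k ∈ a ∧ closure a F i k) ∨
  (i ∈ a ∧ k ∉ a ∧ ∃ j, closure a F i j ∧ F j k) ∨
  (i ∉ a ∧ k ∈ a ∧ ∃ j, F i j ∧ closure a F j k) ∨
  (i ∉ a ∧ k ∉ a ∧ (F i k ∨ ∃ j l, F i j ∧ closure a F j l ∧ F l k))

/-- The edge matrix of a directed acyclic graph: ones on the diagonal and for `i ← k`. -/
def edgeMatrix (D : MixedGraph V) (i k : V) : Prop := i = k ∨ D.arrow i k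

/-- The foster nodes `F` of `C`: ancestors of `C` outside `C`. -/
def foster (D : MixedGraph V) (C : Set V) : Set V := D.ancestors C \ C

/-- The outsiders `O` of `R = C ∪ F`. -/
def outsiders (D : MixedGraph V) (C : Set V) : Set V := D.nodes \ (C ∪ D.foster C)

/-- The induced concentration edge matrix of the foster nodes: `[𝒜_RRᵀ 𝒜_RR]_FF`. -/
def fosterMatrix (D : MixedGraph V) (C : Set V) (i k : V) : Prop :=
  i ∈ D.foster C ∧ k ∈ D.foster C ∧
    ∃ j ∈ C ∪ D.foster C, D.edgeMatrix j i ∧ D.edgeMatrix j k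

/-- The summary graph that the directed acyclic graph `D` induces by conditioning on `C` and
marginalising over `M = (p, q)`, `p = O ∩ M`, `q = F ∩ M`, where `u = O \ M`, `v = F \ M`. With
`𝒟 = zer_p 𝒜`, and `𝒮_qq|vC`, `𝒫_q|v.C`, `𝒮^vv.qO` the blocks of `zer_q` of `fosterMatrix`, its
edge matrices are
* arrows: `ℋ_uu = 𝒟_uu`, `ℋ_uv = In[𝒟_uv + 𝒟_uq 𝒫_q|v.C]`;
* dashed lines: `𝒲_uu = In[ℐ_uu + 𝒟_up 𝒟_upᵀ + 𝒟_uq 𝒮_qq|vC 𝒟_uqᵀ]`;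
* full lines: `𝒮^vv.qO`. -/
def summaryGraph (D : MixedGraph V) (C M : Set V) : MixedGraph V where
  u := D.outsiders C \ M
  v := D.foster C \ M
  arrow i k :=
    (i ∈ D.outsiders C \ M ∧ k ∈ D.outsiders C \ M ∧ i ≠ k ∧
      zer (D.outsiders C ∩ M) D.edgeMatrix i k) ∨
    (i ∈ D.outsiders C \ M ∧ k ∈ D.foster C \ M ∧
      (zer (D.outsiders C ∩ M) D.edgeMatrix i k ∨
        ∃ j ∈ D.foster C ∩ M, zer (D.outsiders C ∩ M) D.edgeMatrix i j ∧
          zer (D.foster C ∩ M) (D.fosterMatrix C) j k))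
  dashed i k := i ∈ D.outsiders C \ M ∧ k ∈ D.outsiders C \ M ∧ i ≠ k ∧
    ((∃ j ∈ D.outsiders C ∩ M, zer (D.outsiders C ∩ M) D.edgeMatrix i j ∧
        zer (D.outsiders C ∩ M) D.edgeMatrix k j) ∨
      (∃ j ∈ D.foster C ∩ M, ∃ l ∈ D.foster C ∩ M,
        zer (D.outsiders C ∩ M) D.edgeMatrix i j ∧
          zer (D.foster C ∩ M) (D.fosterMatrix C) j l ∧
          zer (D.outsiders C ∩ M) D.edgeMatrix k l))
  full i k := i ∈ D.foster C \ M ∧ k ∈ D.foster C \ M ∧ i ≠ k ∧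
    zer (D.foster C ∩ M) (D.fosterMatrix C) i k

/-- `G'` is the independence-preserving summary graph obtained from the summary graph `G` by
conditioning on `S` and marginalising over `T`: a summary graph in the remaining nodes that
preserves the independence structure and that, whenever `G` is generated from a directed acyclic
graph `D` by conditioning on `C` and marginalising over `M`, is the summary graph
generated from `D` by conditioning on `C ∪ S` and marginalising over `M ∪ T`, and preserves the
independence structure of `D`. -/
structure IsSummaryGraphAfter (G : MixedGraph V) (S T : Set V) (G' : MixedGraph V) : Prop where
  isSummaryGraph : G'.IsSummaryGraph
  nodes_eq : G'.nodes = G.nodes \ (S ∪ T)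
  v_eq : G'.v = (G.v ∪ (G.ancestors S ∩ G.u)) \ (S ∪ T)
  preserves : G.PreservesIndependence S G'
  generated : ∀ (D : MixedGraph V) (C M : Set V), D.IsDAG → C ⊆ D.nodes → M ⊆ D.nodes →
    Disjoint C M → G = D.summaryGraph C M →
    G' = D.summaryGraph (C ∪ S) (M ∪ T) ∧ D.PreservesIndependence (C ∪ S) G'

end MixedGraph

/-!
All graphs are viewed through walks between nodes, in which a node may be repeated. An inner node is
a collision node if both marks at it are arrowheads or ends of dashed lines. Let `R` consist of `v`,
of the nodes of `S` and of their ancestors, so that no arrow points into `R` from outside.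
Conditioning on `S` and marginalising over `T` joins two remaining nodes exactly if they are joined
by a walk with collisions in `R` and transmissions in `T`, and the marks at the ends of the new edge
are those of the walk, except that at the nodes of `R` they become tails.

Every order of the inducing steps produces precisely these walks, since one may contract the
transmitting nodes and the collision nodes of a walk in any order. The same contraction shows that
two successive reductions amount to a single one, which gives the independence of the order of all
operations. With a larger set of collision and of transmitting nodes, it also gives the preservation
of independences, since a walk that is open given `c` can be shortened to a path. For a directed
acyclic graph, splitting a walk where it enters and leaves `R` gives the matrix formula for the
summary graph.
-/

namespace MixedGraph

variable {V : Type*}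

/-- Two nodes are joined by an edge with given marks at its ends: `true` stands for an arrowhead or
an end of a dashed line, `false` for the tail of an arrow or an end of a full line. With these marks
an inner node of a walk is a collision node exactly if both marks at it are `true`. -/
def MarkedEdge (G : MixedGraph V) (i : V) (a : Bool) (k : V) (b : Bool) : Prop :=
  match a, b with
  | true, true => G.dashed i k
  | true, false => G.arrow i k
  | false, true => G.arrow k i
  | false, false => G.full i k

/-- Reversing an edge together with its marks gives an edge: dashed and full lines are symmetric. -/
def IsSymm (G : MixedGraph V) : Prop :=
  ∀ i a k b, G.MarkedEdge i a k b → G.MarkedEdge k b i a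

/-- A walk entering `x` with mark `m` and leaving it with mark `m'` is open at `x` when collision
nodes have to be in `R` and transmitting nodes in `T`. -/
def Passes (R T : Set V) (m : Bool) (x : V) (m' : Bool) : Prop :=
  (m = true ∧ m' = true ∧ x ∈ R) ∨ ((m = false ∨ m' = false) ∧ x ∈ T)

/-- Walks from `i` to `k` with mark `a` at `i` and `b` at `k` whose inner collision nodes are in `R`
and whose inner transmitting nodes are in `T`. The edges are given by an arbitrary relation `E`
between marked ends, so that walks can themselves serve as edges. -/
inductive Walk (E : V → Bool → V → Bool → Prop) (R T : Set V) (i : V) (a : Bool) :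
    V → Bool → Prop
  | edge {k : V} {b : Bool} : E i a k b → Walk E R T i a k b
  | step {j k : V} {b b' c : Bool} :
      Walk E R T i a j b → Passes R T b j b' → E j b' k c → Walk E R T i a k c

namespace Passes

variable {R T R' T' : Set V} {x : V} {a b m m' : Bool}

theorem symm (h : Passes R T m x m') : Passes R T m' x m := by
  unfold Passes at *; tauto

theorem mono (h : Passes R T m x m') (hR : R ⊆ R') (hT : T ⊆ T') : Passes R' T' m x m' :=
  h.imp (.imp_right (.imp_right (@hR x))) (.imp_right (@hT x))

theorem mem_union (h : Passes R T m x m') : x ∈ R ∪ T :=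
  h.imp (·.2.2) (·.2)

theorem of_mem (hR : x ∈ R) (hT : x ∈ T) (m m' : Bool) : Passes R T m x m' := by
  cases m <;> cases m' <;> simp [Passes, hR, hT]

/-- A closed section of a walk, with marks `a` and `b` at its ends, can be left out. -/
theorem of_loop (h : x ∈ R ∨ a = true ∨ b = true) (hm : Passes R T m x a)
    (hm' : Passes R T b x m') : Passes R T m x m' := by
  cases m <;> cases m' <;> cases a <;> cases b <;> simp_all [Passes]

end Passes

namespace Walk

variable {E E' : V → Bool → V → Bool → Prop} {R T R' T' : Set V} {i j k x : V} {a b b' c : Bool}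

theorem trans (h : Walk E R T i a j b) (hp : Passes R T b j b') (h' : Walk E R T j b' k c) :
    Walk E R T i a k c := by
  induction h' with
  | edge he => exact .step h hp he
  | step _ hp' he ih => exact .step ih hp' he

theorem symm (hE : ∀ i a k b, E i a k b → E k b i a) (h : Walk E R T i a k b) :
    Walk E R T k b i a := by
  induction h with
  | edge he => exact .edge (hE _ _ _ _ he)
  | step _ hp he ih => exact trans (.edge (hE _ _ _ _ he)) hp.symm ih

theorem bind (hE : ∀ i a k b, E i a k b → Walk E' R' T' i a k b) (hR : R ⊆ R') (hT : T ⊆ T')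
    (h : Walk E R T i a k b) : Walk E' R' T' i a k b := by
  induction h with
  | edge he => exact hE _ _ _ _ he
  | step _ hp he ih => exact trans ih (hp.mono hR hT) (hE _ _ _ _ he)

theorem mono (h : Walk E R T i a k b) (hR : R ⊆ R') (hT : T ⊆ T') : Walk E R' T' i a k b :=
  h.bind (fun _ _ _ _ => .edge) hR hT

theorem edge_of_empty (h : Walk E ∅ ∅ i a k b) : E i a k b := by
  cases h with
  | edge he => exact he
  | step _ hp _ => simpa using hp.mem_union

/-- Cutting a walk at the inner nodes that are not open for `R` and `T`. -/
theorem factor (R T : Set V) (h : Walk E R' T' i a k b) :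
    Walk (Walk E R T) (R' \ R) (T' \ T) i a k b := by
  induction h with
  | edge he => exact .edge (.edge he)
  | @step j k b b' c _ hp he ih =>
    by_cases hj : Passes R T b j b'
    · cases ih with
      | edge h => exact .edge (.step h hj he)
      | step h hp' h' => exact .step h hp' (.step h' hj he)
    · refine .step ih ?_ (.edge he)
      simp only [Passes, Set.mem_sdiff] at hp hj ⊢
      tauto

theorem mapMarks {N : Set V} (f : V → Bool → Bool)
    (hE : ∀ i a k b, i ∈ N → k ∈ N → E i a k b → E' i (f i a) k (f k b))
    (hP : ∀ m x m', Passes R T m x m' → x ∈ N ∧ Passes R' T' (f x m) x (f x m'))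
    (hi : i ∈ N) (hk : k ∈ N) (h : Walk E R T i a k b) :
    Walk E' R' T' i (f i a) k (f k b) := by
  induction h with
  | edge he => exact .edge (hE _ _ _ _ hi hk he)
  | step _ hp he ih =>
    have ⟨hj, hp'⟩ := hP _ _ _ hp
    exact .step (ih hj) hp' (hE _ _ _ _ hj hk he)

theorem erase_loops (hE : ∀ x a b, E x a x b → x ∈ R ∨ a = true ∨ b = true)
    (h : Walk E R T i a k b) : i = k ∨ ∃ a' b',
      Walk (fun i a k b => i ≠ k ∧ E i a k b) R T i a' k b' ∧
        (i ∈ R ∪ T ∨ a' = a) ∧ (k ∈ R ∪ T ∨ b' = b) := by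
  suffices i = k ∨ ∃ a' b', Walk (fun i a k b => i ≠ k ∧ E i a k b) R T i a' k b' ∧
      (i ∈ R ∪ T ∨ a' = a) ∧ (k ∈ R ∪ T ∨ b' = b) ∧
        ∀ m, Passes R T b k m → Passes R T b' k m from
    this.imp_right fun ⟨a', b', h, ha, hb, _⟩ => ⟨a', b', h, ha, hb⟩
  induction h with
  | @edge k b he =>
    exact or_iff_not_imp_left.2 fun hne =>
      ⟨a, b, .edge ⟨hne, he⟩, .inr rfl, .inr rfl, fun _ => id⟩
  | @step j k b b' c _ hp he ih =>
    refine or_iff_not_imp_left.2 fun hik => ?_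
    rcases ih with rfl | ⟨a', b₁, h, ha, -, hb₁⟩
    · exact ⟨b', c, .edge ⟨hik, he⟩, .inl hp.mem_union, .inr rfl, fun _ => id⟩
    by_cases hjk : j = k
    · subst hjk
      exact ⟨a', b₁, h, ha, .inl hp.mem_union, fun m hm => hb₁ m (hp.of_loop (hE _ _ _ he) hm)⟩
    · exact ⟨a', c, .step h (hb₁ _ hp) ⟨hjk, he⟩, ha, .inr rfl, fun _ => id⟩

/-- Splitting a walk at its first and last collision at `x`. -/
theorem split_collision (h : Walk E (insert x R) T i a k b) :
    Walk E R T i a k b ∨ (Walk E R T i a x true ∧ Walk E R T x true k b) := by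
  induction h with
  | edge he => exact Or.inl (.edge he)
  | @step j k b b' c _ hp he ih =>
    by_cases hp' : Passes R T b j b'
    · exact ih.imp (.step · hp' he) fun h => ⟨h.1, .step h.2 hp' he⟩
    · obtain ⟨rfl, rfl, rfl⟩ : b = true ∧ b' = true ∧ j = x := by
        simp only [Passes, Set.mem_insert_iff] at hp hp'
        tauto
      exact Or.inr ⟨ih.elim id (·.1), .edge he⟩

/-- Splitting a walk at its first and last transmission at the only node of `T`. -/
theorem split_transmission (hT : T.Subsingleton)
    (hloop : ∀ t ∈ T, Walk E R ∅ t false t false → t ∈ R) (h : Walk E R T i a k b) :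
    Walk E R ∅ i a k b ∨ ∃ t ∈ T, ∃ m m',
      Walk E R ∅ i a t m ∧ Passes R T m t m' ∧ Walk E R ∅ t m' k b := by
  induction h with
  | edge he => exact Or.inl (.edge he)
  | @step j k b b' c _ hp he ih =>
    by_cases hp' : Passes R ∅ b j b'
    · exact ih.imp (.step · hp' he) fun ⟨t, ht, m, m', h, hm, h'⟩ =>
        ⟨t, ht, m, m', h, hm, .step h' hp' he⟩
    have hj : j ∈ T := by
      simp only [Passes, Set.mem_empty_iff_false, and_false, or_false] at hp hp'
      tauto
    refine Or.inr ⟨j, hj, ?_⟩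
    rcases ih with h | ⟨t, ht, m, m', h, hm, h'⟩
    · exact ⟨b, b', h, hp, .edge he⟩
    obtain rfl := hT ht hj
    have hopen : t ∈ R ∨ m' = true ∨ b = true := by
      cases m' <;> cases b <;> simp_all
    exact ⟨m, b', h, hm.of_loop hopen hp, .edge he⟩

end Walk

theorem coupled_iff (G : MixedGraph V) (i k : V) :
    G.Coupled i k ↔ ∃ a b, G.MarkedEdge i a k b := by
  simp only [Coupled, MarkedEdge, Bool.exists_bool]
  tauto

theorem ext_markedEdge {G H : MixedGraph V} (hu : G.u = H.u) (hv : G.v = H.v)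
    (h : ∀ i a k b, G.MarkedEdge i a k b ↔ H.MarkedEdge i a k b) : G = H :=
  MixedGraph.ext hu hv (funext₂ fun i k => propext (h i true k false))
    (funext₂ fun i k => propext (h i true k true)) (funext₂ fun i k => propext (h i false k false))

namespace IsSummaryGraph

variable {G : MixedGraph V} {R T : Set V} {i k : V} {a b : Bool}

theorem isSymm (hG : G.IsSummaryGraph) : G.IsSymm := by
  rintro i (_ | _) k (_ | _) h
  exacts [hG.full_symm _ _ h, h, h, hG.dashed_symm _ _ h]

theorem mem_nodes_right (hG : G.IsSummaryGraph) (h : G.MarkedEdge i a k b) : k ∈ G.nodes := by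
  cases a <;> cases b
  exacts [Or.inr (hG.full_mem _ _ h).2.1, Or.inl (hG.arrow_mem _ _ h).1, (hG.arrow_mem _ _ h).2,
    Or.inl (hG.dashed_mem _ _ h).2.1]

theorem mem_u_of_head (hG : G.IsSummaryGraph) (h : G.MarkedEdge i a k true) : k ∈ G.u := by
  cases a
  exacts [(hG.arrow_mem _ _ h).1, (hG.dashed_mem _ _ h).2.1]

theorem markedEdge_ne (hG : G.IsSummaryGraph) (h : G.MarkedEdge i a k b) : i ≠ k := by
  rintro rfl
  cases a <;> cases b
  exacts [(hG.full_mem _ _ h).2.2 rfl, hG.acyclic i (.single h), hG.acyclic i (.single h),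
    (hG.dashed_mem _ _ h).2.2 rfl]

theorem walk_symm (hG : G.IsSummaryGraph) (h : Walk G.MarkedEdge R T i a k b) :
    Walk G.MarkedEdge R T k b i a :=
  h.symm hG.isSymm

theorem walk_mem_nodes (hG : G.IsSummaryGraph) (h : Walk G.MarkedEdge R T i a k b) :
    k ∈ G.nodes := by
  cases h with
  | edge he => exact hG.mem_nodes_right he
  | step _ _ he => exact hG.mem_nodes_right he

theorem walk_mem_u (hG : G.IsSummaryGraph) (h : Walk G.MarkedEdge R T i a k true) : k ∈ G.u := by
  cases h with
  | edge he => exact hG.mem_u_of_head he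
  | step _ _ he => exact hG.mem_u_of_head he

theorem ancestors_subset (hG : G.IsSummaryGraph) (S : Set V) : G.ancestors S ⊆ G.nodes := by
  rintro k ⟨s, -, h⟩
  obtain ⟨j, hj, -⟩ := Relation.TransGen.head'_iff.1 h
  exact (hG.arrow_mem _ _ hj).2

theorem mem_of_closed_walk (hG : G.IsSummaryGraph) (hR : ∀ i k, G.arrow i k → i ∈ R → k ∈ R)
    (h : Walk G.MarkedEdge R ∅ i false i false) : i ∈ R := by
  cases h with
  | edge he => exact absurd rfl (hG.markedEdge_ne he)
  | @step j _ _ _ _ _ hp he =>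
    rcases hp with ⟨-, rfl, hj⟩ | ⟨-, hj⟩
    exacts [hR _ _ he hj, hj.elim]

end IsSummaryGraph

/-- A walk of at least one arrow from `i` to `k`, in the direction of the arrows, with all inner
nodes in `T`. -/
inductive DirectedWalk (G : MixedGraph V) (T : Set V) (i : V) : V → Prop
  | edge {k : V} : G.arrow k i → DirectedWalk G T i k
  | step {j k : V} : DirectedWalk G T i j → j ∈ T → G.arrow k j → DirectedWalk G T i k

namespace DirectedWalk

variable {G : MixedGraph V} {T : Set V} {i j k s : V}

theorem isAncestor (h : G.DirectedWalk T i k) : G.IsAncestor i k := by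
  induction h with
  | edge he => exact .single he
  | step _ _ he ih => exact .tail ih he

theorem walk (h : G.DirectedWalk T i k) (R : Set V) : Walk G.MarkedEdge R T i false k true := by
  induction h with
  | edge he => exact .edge he
  | step _ hj he ih => exact .step ih (Or.inr ⟨.inr rfl, hj⟩) he

theorem exists_notMem (h : G.DirectedWalk T i j) (hs : s ∉ T)
    (hj : Relation.ReflTransGen (fun x y => G.arrow y x) j s) :
    ∃ r, r ∉ T ∧ G.DirectedWalk T i r ∧ Relation.ReflTransGen (fun x y => G.arrow y x) r s := by
  induction hj using Relation.ReflTransGen.head_induction_on with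
  | refl => exact ⟨s, hs, h, .refl⟩
  | @head j j' he hj' ih =>
    by_cases hj : j ∈ T
    · exact ih (h.step hj he)
    · exact ⟨j, hj, h, .head he hj'⟩

end DirectedWalk

theorem IsAncestor.exists_directedWalk_notMem {G : MixedGraph V} {T : Set V} {i s : V}
    (h : G.IsAncestor i s) (hs : s ∉ T) : ∃ r, r ∉ T ∧ G.DirectedWalk T i r ∧
      Relation.ReflTransGen (fun x y => G.arrow y x) r s := by
  obtain ⟨j, hj, h⟩ := Relation.TransGen.head'_iff.1 h
  exact (DirectedWalk.edge hj).exists_notMem hs h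

/-- A set of nodes that contains `v` and all ancestors of its elements. -/
structure IsAncestral (G : MixedGraph V) (R : Set V) : Prop where
  v_subset : G.v ⊆ R
  parent_mem : ∀ i k, G.arrow i k → i ∈ R → k ∈ R

/-- The least ancestral set containing `S`: the nodes at which conditioning on `S` opens collisions,
together with `v`, where no collision occurs. -/
def condClosure (G : MixedGraph V) (S : Set V) : Set V := G.v ∪ S ∪ G.ancestors S

namespace IsAncestral

variable {G : MixedGraph V} {R S T : Set V} {i k x : V} {a b : Bool}

theorem ancestor_mem (hR : G.IsAncestral R) (h : G.IsAncestor k i) (hi : i ∈ R) : k ∈ R := by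
  induction h with
  | single he => exact hR.parent_mem _ _ he hi
  | tail _ he ih => exact ih (hR.parent_mem _ _ he hi)

theorem condClosure_subset (hR : G.IsAncestral R) (hS : S ⊆ R) : G.condClosure S ⊆ R :=
  Set.union_subset (Set.union_subset hR.v_subset hS) fun _ ⟨_, hs, h⟩ => hR.ancestor_mem h (hS hs)

/-- A walk that leaves a node outside an ancestral set through a tail never meets a collision node
of that set, so it keeps its direction. -/
theorem directedWalk (hR : G.IsAncestral R) (hG : G.IsSummaryGraph)
    (h : Walk G.MarkedEdge R T i false k b) (hi : i ∉ R) : b = true ∧ G.DirectedWalk T i k := by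
  have tail_head : ∀ {i k b}, G.MarkedEdge i false k b → i ∉ R → b = true := by
    rintro i k (_ | _) he hi
    exacts [absurd (hR.v_subset (hG.full_mem _ _ he).1) hi, rfl]
  induction h with
  | edge he =>
    obtain rfl := tail_head he hi
    exact ⟨rfl, .edge he⟩
  | @step j k b b' c hw hp he ih =>
    obtain ⟨rfl, hd⟩ := ih
    have hj : j ∉ R := mt (hR.ancestor_mem hd.isAncestor) hi
    rcases hp with ⟨-, -, hj'⟩ | ⟨hb, hjT⟩
    · exact absurd hj' hj
    · obtain rfl : b' = false := by simpa using hb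
      obtain rfl := tail_head he hj
      exact ⟨rfl, .step hd hjT he⟩

theorem head_of_mem (hR : G.IsAncestral R) (hG : G.IsSummaryGraph)
    (h : Walk G.MarkedEdge R T i a k b) (hi : i ∉ R) (hk : k ∈ R) : a = true := by
  cases a
  · exact absurd (hR.ancestor_mem (hR.directedWalk hG h hi).2.isAncestor hk) hi
  · rfl

theorem mem_or_head_of_closed_walk (hR : G.IsAncestral R) (hG : G.IsSummaryGraph)
    (h : Walk G.MarkedEdge R T x a x b) : x ∈ R ∨ a = true ∨ b = true := by
  by_contra! hne
  obtain ⟨hx, ha, -⟩ := hne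
  obtain rfl : a = false := by simpa using ha
  exact hG.acyclic x (hR.directedWalk hG h hx).2.isAncestor

/-- A walk that left an ancestral set could only return through a collision node outside of it. -/
theorem walk_within (hR : G.IsAncestral R) (hG : G.IsSummaryGraph)
    (h : Walk G.MarkedEdge R T i a k b) (hi : i ∈ R) (hk : k ∈ R) :
    Walk G.MarkedEdge R (R ∩ T) i a k b := by
  induction h with
  | edge he => exact .edge he
  | @step j k b b' c hw hp he ih =>
    by_cases hj : j ∈ R
    · exact (ih hj).step (hp.imp id fun ⟨hb, hT⟩ => ⟨hb, hj, hT⟩) he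
    · obtain rfl := hR.head_of_mem hG (hG.walk_symm hw) hj hi
      obtain rfl := hR.head_of_mem (T := T) hG (.edge he) hj hk
      simp [Passes, hj] at hp

end IsAncestral

section CondClosure

variable {G : MixedGraph V} {S S' T : Set V} {i k : V} {a b : Bool}

theorem subset_condClosure : S ⊆ G.condClosure S := fun _ h => Or.inl (Or.inr h)

theorem isAncestral_condClosure (hG : G.IsSummaryGraph) (S : Set V) :
    G.IsAncestral (G.condClosure S) where
  v_subset _ h := Or.inl (Or.inl h)
  parent_mem i k h hi := by
    rcases hi with (hi | hi) | ⟨s, hs, hi⟩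
    · exact absurd hi (hG.disjoint.notMem_of_mem_left (hG.arrow_mem _ _ h).1)
    · exact Or.inr ⟨i, hi, .single h⟩
    · exact Or.inr ⟨s, hs, .head h hi⟩

theorem condClosure_mono (hG : G.IsSummaryGraph) (h : S ⊆ S') :
    G.condClosure S ⊆ G.condClosure S' :=
  (isAncestral_condClosure hG S').condClosure_subset (h.trans subset_condClosure)

theorem condClosure_subset_nodes (hG : G.IsSummaryGraph) (hS : S ⊆ G.nodes) :
    G.condClosure S ⊆ G.nodes :=
  IsAncestral.condClosure_subset ⟨Set.subset_union_right, fun i k h _ => (hG.arrow_mem i k h).2⟩ hS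

/-- A collision at a node of `T` that is opened by its descendant in `S` is replaced by a detour: go
down to the first node outside `T`, which is itself opened by `S`, and return. -/
theorem walk_condClosure (hG : G.IsSummaryGraph) (hST : Disjoint S T)
    (h : Walk G.MarkedEdge (G.condClosure S) T i a k b) :
    Walk G.MarkedEdge ((S ∪ G.ancestors S) \ T) T i a k b := by
  induction h with
  | edge he => exact .edge he
  | @step j k b b' c hw hp he ih =>
    rcases hp with ⟨rfl, rfl, hj⟩ | hp
    · replace hj : j ∈ S ∪ G.ancestors S := by
        have hv := hG.disjoint.notMem_of_mem_left (hG.walk_mem_u hw)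
        simpa only [condClosure, Set.mem_union, hv, false_or] using hj
      by_cases hjT : j ∈ T
      · obtain ⟨s, hs, hanc⟩ := hj.resolve_left fun h => hST.notMem_of_mem_left h hjT
        obtain ⟨r, hrT, hd, hr⟩ :=
          hanc.exists_directedWalk_notMem (hST.notMem_of_mem_left hs)
        have hrS : r ∈ S ∪ G.ancestors S := by
          rcases Relation.reflTransGen_iff_eq_or_transGen.1 hr with rfl | hr
          exacts [Or.inl hs, Or.inr ⟨s, hs, hr⟩]
        have down := ih.trans (Or.inr ⟨Or.inr rfl, hjT⟩) (hd.walk _)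
        have back := down.trans (Or.inl ⟨rfl, rfl, hrS, hrT⟩) (hG.walk_symm (hd.walk _))
        exact back.step (Or.inr ⟨Or.inl rfl, hjT⟩) he
      · exact ih.step (Or.inl ⟨rfl, rfl, hj, hjT⟩) he
    · exact ih.step (Or.inr hp) he

end CondClosure

open Classical in
/-- The mark `m` at `x` as it is seen after re-typing, which turns the ends of all edges at the
nodes of `R` into tails or ends of full lines. -/
noncomputable def seenMark (R : Set V) (x : V) (m : Bool) : Bool := if x ∈ R then false else m

section SeenMark

variable {R R' : Set V} {x : V}

theorem seenMark_of_mem (h : x ∈ R) (m : Bool) : seenMark R x m = false := if_pos h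

theorem seenMark_of_notMem (h : x ∉ R) (m : Bool) : seenMark R x m = m := if_neg h

theorem seenMark_seenMark (h : x ∈ R → x ∈ R') (m : Bool) :
    seenMark R' x (seenMark R x m) = seenMark R' x m := by
  by_cases hx : x ∈ R
  · simp only [seenMark_of_mem (h hx)]
  · rw [seenMark_of_notMem hx]

theorem seenMark_congr (h : x ∈ R ↔ x ∈ R') (m : Bool) : seenMark R x m = seenMark R' x m := by
  by_cases hx : x ∈ R
  · rw [seenMark_of_mem hx, seenMark_of_mem (h.1 hx)]
  · rw [seenMark_of_notMem hx, seenMark_of_notMem (mt h.2 hx)]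

theorem seenMark_eq_of_mem_or_eq {m m' : Bool} (h : x ∈ R ∨ m = m') :
    seenMark R x m = seenMark R x m' := by
  rcases h with h | rfl
  exacts [by simp only [seenMark_of_mem h], rfl]

end SeenMark

theorem markedEdge_retype {K : MixedGraph V} {u' v' R : Set V} (hu : Disjoint u' R) (hv : v' ⊆ R)
    (hK : K.IsSymm) (head : ∀ i a k b, i ∈ u' → k ∈ v' → K.MarkedEdge i a k b → a = true)
    {i k : V} {a b : Bool} :
    (retype u' v' K).MarkedEdge i a k b ↔ i ∈ u' ∪ v' ∧ k ∈ u' ∪ v' ∧ ∃ a₀ b₀,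
      K.MarkedEdge i a₀ k b₀ ∧ seenMark R i a₀ = a ∧ seenMark R k b₀ = b := by
  have onU {x} (hx : x ∈ u') : x ∉ v' ∧ ∀ m, seenMark R x m = m :=
    ⟨fun h => hu.notMem_of_mem_left hx (hv h), seenMark_of_notMem (hu.notMem_of_mem_left hx)⟩
  have onV {x} (hx : x ∈ v') : x ∉ u' ∧ ∀ m, seenMark R x m = false :=
    ⟨hu.notMem_of_mem_right (hv hx), seenMark_of_mem (hv hx)⟩
  have outside {x} (hx : x ∉ u' ∪ v') : x ∉ u' ∧ x ∉ v' := by simpa using hx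
  by_cases hi : i ∈ u' ∪ v'
  swap; · cases a <;> cases b <;> simp [MarkedEdge, retype, outside hi]
  by_cases hk : k ∈ u' ∪ v'
  swap; · cases a <;> cases b <;> simp [MarkedEdge, retype, outside hk]
  simp only [hi, hk, true_and]
  rcases hi with hi | hi <;> rcases hk with hk | hk
  · cases a <;> cases b <;> simp [MarkedEdge, retype, onU hi, onU hk, hi, hk]
  · have hfull : ¬ K.full i k := fun h => Bool.false_ne_true (head i false k false hi hk h)
    have harrow : ¬ K.arrow k i := fun h => Bool.false_ne_true (head i false k true hi hk h)
    cases a <;> cases b <;>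
      simp [MarkedEdge, retype, onU hi, onV hk, hi, hk, coupled_iff, hfull, harrow, or_comm]
  · have hfull : ¬ K.full k i := fun h => Bool.false_ne_true (head k false i false hk hi h)
    have hfull' : ¬ K.full i k := fun h => hfull (hK i false k false h)
    have harrow : ¬ K.arrow i k := fun h => Bool.false_ne_true (head k false i true hk hi h)
    have hdashed : K.dashed k i ↔ K.dashed i k := ⟨hK k true i true, hK i true k true⟩
    cases a <;> cases b <;>
      simp [MarkedEdge, retype, onV hi, onU hk, hi, hk, Coupled, hfull, hfull', harrow, hdashed]
  · cases a <;> cases b <;> simp [MarkedEdge, retype, onV hi, onV hk, hi, hk, coupled_iff]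

/-- The pairs of distinct nodes joined by walks with collisions in `R` and transmissions in `T`,
each with an edge of the kind given by the marks at the ends of the walk. -/
def walkGraph (G : MixedGraph V) (R T : Set V) : MixedGraph V where
  u := G.u
  v := G.v
  arrow i k := i ≠ k ∧ Walk G.MarkedEdge R T i true k false
  dashed i k := i ≠ k ∧ Walk G.MarkedEdge R T i true k true
  full i k := i ≠ k ∧ Walk G.MarkedEdge R T i false k false

/-- The graph obtained by conditioning on `S` and marginalising over `T` all at once: every walk
that is open between two remaining nodes induces an edge. -/
def reduce (G : MixedGraph V) (S T : Set V) : MixedGraph V :=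
  retype (G.newU S T) (G.newV S T) (G.walkGraph (G.condClosure S) T)

/-- The edges of `G.reduce S T`, described through walks in `G` and including loops. -/
def ReducedEdge (G : MixedGraph V) (S T : Set V) (i : V) (a : Bool) (k : V) (b : Bool) : Prop :=
  i ∈ G.nodes \ (S ∪ T) ∧ k ∈ G.nodes \ (S ∪ T) ∧ ∃ a₀ b₀,
    Walk G.MarkedEdge (G.condClosure S) T i a₀ k b₀ ∧
      seenMark (G.condClosure S) i a₀ = a ∧ seenMark (G.condClosure S) k b₀ = b

section Reduce

variable {G : MixedGraph V} {S T : Set V} {i k x : V} {a b : Bool}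

theorem markedEdge_walkGraph (hG : G.IsSymm) {R : Set V} : (G.walkGraph R T).MarkedEdge i a k b ↔
    i ≠ k ∧ Walk G.MarkedEdge R T i a k b := by
  cases a <;> cases b
  exacts [Iff.rfl, ⟨fun h => ⟨h.1.symm, h.2.symm hG⟩, fun h => ⟨h.1.symm, h.2.symm hG⟩⟩, Iff.rfl,
    Iff.rfl]

theorem coupled_walkGraph (hG : G.IsSymm) {R : Set V} :
    (G.walkGraph R T).Coupled i k ↔ i ≠ k ∧ ∃ a b, Walk G.MarkedEdge R T i a k b := by
  simp only [coupled_iff, markedEdge_walkGraph hG, exists_and_left]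

theorem newV_eq (hG : G.IsSummaryGraph) (S T : Set V) :
    G.newV S T = G.condClosure S \ (S ∪ T) := by
  ext x
  have hx : x ∈ G.ancestors S → x ∈ G.nodes := fun h => hG.ancestors_subset S h
  simp only [newV, condClosure, nodes, Set.mem_sdiff, Set.mem_union, Set.mem_inter_iff] at hx ⊢
  tauto

theorem newU_eq (hG : G.IsSummaryGraph) (S T : Set V) :
    G.newU S T = (G.nodes \ (S ∪ T)) \ G.condClosure S := by
  ext x
  simp only [newU, newV_eq hG, Set.mem_sdiff, Set.mem_union]
  tauto

theorem newU_union_newV (hG : G.IsSummaryGraph) (hS : S ⊆ G.nodes) (T : Set V) :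
    G.newU S T ∪ G.newV S T = G.nodes \ (S ∪ T) := by
  have hR := condClosure_subset_nodes hG hS
  rw [newU_eq hG, newV_eq hG]
  ext x
  have hx : x ∈ G.condClosure S → x ∈ G.nodes := fun h => hR h
  simp only [Set.mem_union, Set.mem_sdiff]
  by_cases hxR : x ∈ G.condClosure S <;> simp_all

theorem disjoint_newU_condClosure (hG : G.IsSummaryGraph) (S T : Set V) :
    Disjoint (G.newU S T) (G.condClosure S) := by
  rw [newU_eq hG]
  exact Set.disjoint_sdiff_left

theorem newV_subset_condClosure (hG : G.IsSummaryGraph) (S T : Set V) :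
    G.newV S T ⊆ G.condClosure S := by
  rw [newV_eq hG]
  exact Set.sdiff_subset

theorem markedEdge_retype_of_sound (hG : G.IsSummaryGraph) (hS : S ⊆ G.nodes)
    {K : MixedGraph V} (hK : K.IsSymm)
    (sound : ∀ i a k b, K.MarkedEdge i a k b → Walk G.MarkedEdge (G.condClosure S) T i a k b) :
    (retype (G.newU S T) (G.newV S T) K).MarkedEdge i a k b ↔
      i ∈ G.nodes \ (S ∪ T) ∧ k ∈ G.nodes \ (S ∪ T) ∧ ∃ a₀ b₀, K.MarkedEdge i a₀ k b₀ ∧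
        seenMark (G.condClosure S) i a₀ = a ∧ seenMark (G.condClosure S) k b₀ = b := by
  rw [markedEdge_retype (disjoint_newU_condClosure hG S T) (newV_subset_condClosure hG S T) hK,
    newU_union_newV hG hS]
  intro i a k b hi hk h
  exact (isAncestral_condClosure hG S).head_of_mem hG (sound _ _ _ _ h)
    ((disjoint_newU_condClosure hG S T).notMem_of_mem_left hi) (newV_subset_condClosure hG S T hk)

theorem markedEdge_reduce (hG : G.IsSummaryGraph) (hS : S ⊆ G.nodes) :
    (G.reduce S T).MarkedEdge i a k b ↔ i ≠ k ∧ G.ReducedEdge S T i a k b := by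
  have hsymm : (G.walkGraph (G.condClosure S) T).IsSymm := fun i a k b h =>
    (markedEdge_walkGraph hG.isSymm).2 <|
      ((markedEdge_walkGraph hG.isSymm).1 h).imp Ne.symm hG.walk_symm
  rw [reduce, markedEdge_retype_of_sound hG hS hsymm fun i a k b h =>
    ((markedEdge_walkGraph hG.isSymm).1 h).2]
  simp only [markedEdge_walkGraph hG.isSymm, ReducedEdge]
  tauto

theorem nodes_reduce (hG : G.IsSummaryGraph) (hS : S ⊆ G.nodes) (T : Set V) :
    (G.reduce S T).nodes = G.nodes \ (S ∪ T) :=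
  newU_union_newV hG hS T

theorem directedWalk_of_arrow_reduce (hG : G.IsSummaryGraph) (hS : S ⊆ G.nodes)
    (h : (G.reduce S T).arrow i k) (hk : k ∉ G.condClosure S) : G.DirectedWalk T k i := by
  obtain ⟨-, -, -, a, b, hw, -, hb⟩ :=
    (markedEdge_reduce (a := true) (b := false) hG hS).1 h
  obtain rfl : b = false := (seenMark_of_notMem hk b).symm.trans hb
  exact ((isAncestral_condClosure hG S).directedWalk hG (hG.walk_symm hw) hk).2

theorem IsAncestral.reduce {R : Set V} (hR : G.IsAncestral R) (hG : G.IsSummaryGraph)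
    (hS : S ⊆ G.nodes) (hSR : S ⊆ R) (T : Set V) : (G.reduce S T).IsAncestral R where
  v_subset := (newV_subset_condClosure hG S T).trans (hR.condClosure_subset hSR)
  parent_mem i k h hi := by
    by_cases hk : k ∈ G.condClosure S
    · exact hR.condClosure_subset hSR hk
    · exact hR.ancestor_mem (directedWalk_of_arrow_reduce hG hS h hk).isAncestor hi

theorem isAncestor_of_isAncestor_reduce (hG : G.IsSummaryGraph) (hS : S ⊆ G.nodes)
    (h : (G.reduce S T).IsAncestor k i) (hk : k ∉ G.condClosure S) : G.IsAncestor k i := by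
  induction h using Relation.TransGen.head_induction_on with
  | single he => exact (directedWalk_of_arrow_reduce hG hS he hk).isAncestor
  | head he _ ih =>
    have hd := (directedWalk_of_arrow_reduce hG hS he hk).isAncestor
    exact hd.trans (ih (mt ((isAncestral_condClosure hG S).ancestor_mem hd) hk))

theorem isSymm_reduce (hG : G.IsSummaryGraph) (hS : S ⊆ G.nodes) : (G.reduce S T).IsSymm := by
  intro i a k b h
  obtain ⟨hne, hi, hk, a₀, b₀, hw, ha, hb⟩ := (markedEdge_reduce hG hS).1 h
  exact (markedEdge_reduce hG hS).2 ⟨hne.symm, hk, hi, b₀, a₀, hG.walk_symm hw, hb, ha⟩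

theorem isSummaryGraph_reduce (hG : G.IsSummaryGraph) (hS : S ⊆ G.nodes) (T : Set V) :
    (G.reduce S T).IsSummaryGraph := by
  have hu := disjoint_newU_condClosure hG S T
  have hne {i a k b} (h : (G.reduce S T).MarkedEdge i a k b) : i ≠ k :=
    ((markedEdge_reduce hG hS).1 h).1
  have arrow_mem {i k} (h : (G.reduce S T).arrow i k) :
      i ∈ G.newU S T ∧ k ∈ (G.reduce S T).nodes :=
    h.elim (fun h => ⟨h.1, Or.inl h.2.1⟩) fun h => ⟨h.1, Or.inr h.2.1⟩
  refine ⟨hu.mono_right (newV_subset_condClosure hG S T), fun _ _ => arrow_mem, fun i h => ?_,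
    fun i k h => ⟨h.1, h.2.1, hne (a := true) (b := true) h⟩,
    fun i k => isSymm_reduce hG hS i true k true, fun i k h => ?_,
    fun i k => isSymm_reduce hG hS i false k false⟩
  · obtain ⟨_, -, he⟩ := Relation.TransGen.tail'_iff.1 h
    exact hG.acyclic i <| isAncestor_of_isAncestor_reduce hG hS h <|
      hu.notMem_of_mem_left (arrow_mem he).1
  · rcases h with ⟨hi, -, -, hw⟩ | h
    · exact absurd ((isAncestral_condClosure hG S).directedWalk hG hw
        (hu.notMem_of_mem_left hi)).1 Bool.false_ne_true
    · exact ⟨h.1, h.2.1, hne (a := false) (b := false) (Or.inr h)⟩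

end Reduce

section Iterate

variable {G : MixedGraph V} {S T S' T' R R' : Set V} {i j k s x : V} {a b m m' : Bool}

theorem arrow_reduce_of_directedWalk (hG : G.IsSummaryGraph) (hS : S ⊆ G.nodes)
    (h : G.DirectedWalk T i k) (hi : i ∈ G.nodes \ (S ∪ T)) (hiR : i ∉ G.condClosure S)
    (hk : k ∉ T) : (G.reduce S T).arrow k i := by
  have hw := h.walk (G.condClosure S)
  have hkR := mt ((isAncestral_condClosure hG S).ancestor_mem h.isAncestor) hiR
  refine (markedEdge_reduce (a := true) (b := false) hG hS).2 ⟨?_, ⟨hG.walk_mem_nodes hw, ?_⟩, hi,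
    true, false, hG.walk_symm hw, seenMark_of_notMem hkR _, seenMark_of_notMem hiR _⟩
  · rintro rfl
    exact hG.acyclic _ h.isAncestor
  · rintro (hkS | hkT)
    exacts [hkR (subset_condClosure hkS), hk hkT]

theorem isAncestor_reduce_of_directedWalk (hG : G.IsSummaryGraph) (hS : S ⊆ G.nodes)
    (h : G.DirectedWalk T i j) (hi : i ∈ G.nodes \ (S ∪ T)) (hiR : i ∉ G.condClosure S)
    (hs : s ∉ T) (hj : Relation.ReflTransGen (fun x y => G.arrow y x) j s) :
    (G.reduce S T).IsAncestor i s := by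
  induction hj using Relation.ReflTransGen.head_induction_on generalizing i with
  | refl => exact .single (arrow_reduce_of_directedWalk hG hS h hi hiR hs)
  | @head j j' he _ ih =>
    by_cases hj : j ∈ T
    · exact ih (h.step hj he) hi hiR
    · have hjR := mt ((isAncestral_condClosure hG S).ancestor_mem h.isAncestor) hiR
      have harrow := arrow_reduce_of_directedWalk hG hS h hi hiR hj
      refine .head harrow (ih (.edge he) ?_ hjR)
      exact nodes_reduce hG hS T ▸
        Or.inl ((isSummaryGraph_reduce hG hS T).arrow_mem _ _ harrow).1

theorem condClosure_reduce (hG : G.IsSummaryGraph) (hS : S ⊆ G.nodes)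
    (hS' : S' ⊆ (G.reduce S T).nodes) :
    (G.reduce S T).condClosure S' = G.condClosure (S ∪ S') \ (S ∪ T) := by
  have hG' := isSummaryGraph_reduce hG hS T
  have hR := isAncestral_condClosure hG (S ∪ S')
  rw [nodes_reduce hG hS] at hS'
  refine Set.Subset.antisymm (fun x hx => ⟨?_, ?_⟩) fun x ⟨hx, hxST⟩ => ?_
  · exact (hR.reduce hG hS (Set.subset_union_left.trans subset_condClosure) T).condClosure_subset
      (Set.subset_union_right.trans subset_condClosure) hx
  · exact (nodes_reduce hG hS T ▸
      condClosure_subset_nodes hG' (nodes_reduce hG hS T ▸ hS') hx :).2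
  by_cases hxR : x ∈ G.condClosure S
  · have hxV : x ∈ (G.reduce S T).v := (newV_eq hG S T).symm.subset ⟨hxR, hxST⟩
    exact Or.inl (Or.inl hxV)
  rcases hx with (hx | hx | hx) | ⟨s, hs | hs, hx⟩
  · exact absurd (Or.inl (Or.inl hx)) hxR
  · exact absurd (Or.inl hx) hxST
  · exact Or.inl (Or.inr hx)
  · exact absurd (Or.inr ⟨s, hs, hx⟩) hxR
  · obtain ⟨j, hj, hjs⟩ := Relation.TransGen.head'_iff.1 hx
    exact Or.inr ⟨s, hs, isAncestor_reduce_of_directedWalk hG hS (.edge hj)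
      ⟨hG.ancestors_subset S' ⟨s, hs, hx⟩, hxST⟩ hxR (fun h => (hS' hs).2 (Or.inr h)) hjs⟩

theorem Passes.of_seenMark (hR : R ⊆ R') (h : Passes R' T (seenMark R x m) x (seenMark R x m')) :
    Passes R' T m x m' := by
  by_cases hx : x ∈ R
  · simp only [seenMark_of_mem hx] at h
    exact .of_mem (hR hx) (by simpa [Passes] using h) m m'
  · simpa only [seenMark_of_notMem hx] using h

theorem Passes.seenMark (hR : Disjoint R R') (h : Passes R' T m x m') :
    Passes R' T (seenMark R x m) x (seenMark R x m') := by
  by_cases hx : x ∈ R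
  · have hxT : x ∈ T := h.mem_union.resolve_left (hR.notMem_of_mem_left hx)
    exact Or.inr ⟨Or.inl (seenMark_of_mem hx m), hxT⟩
  · simpa only [seenMark_of_notMem hx] using h

theorem exists_walk_of_walk_reduce (hG : G.IsSummaryGraph) (hS : S ⊆ G.nodes)
    (hS' : S' ⊆ (G.reduce S T).nodes)
    (h : Walk (G.reduce S T).MarkedEdge ((G.reduce S T).condClosure S') T' i a k b) :
    ∃ a₀ b₀, Walk G.MarkedEdge (G.condClosure (S ∪ S')) (T ∪ T') i a₀ k b₀ ∧
      seenMark (G.condClosure S) i a₀ = a ∧ seenMark (G.condClosure S) k b₀ = b := by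
  have hR : G.condClosure S ⊆ G.condClosure (S ∪ S') := condClosure_mono hG Set.subset_union_left
  have edge_walk {i a k b} (h : (G.reduce S T).MarkedEdge i a k b) :
      ∃ a₀ b₀, Walk G.MarkedEdge (G.condClosure (S ∪ S')) (T ∪ T') i a₀ k b₀ ∧
        seenMark (G.condClosure S) i a₀ = a ∧ seenMark (G.condClosure S) k b₀ = b := by
    obtain ⟨-, -, -, a₀, b₀, hw, hab⟩ := (markedEdge_reduce hG hS).1 h
    exact ⟨a₀, b₀, hw.mono hR Set.subset_union_left, hab⟩
  rw [condClosure_reduce hG hS hS'] at h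
  induction h with
  | edge he => exact edge_walk he
  | step _ hp he ih =>
    obtain ⟨a₀, b₀, hw, ha, rfl⟩ := ih
    obtain ⟨b₁, c₀, hw', rfl, hc⟩ := edge_walk he
    have hp' : Passes (G.condClosure (S ∪ S')) (T ∪ T') b₀ _ b₁ :=
      (hp.mono Set.sdiff_subset Set.subset_union_right).of_seenMark hR
    exact ⟨a₀, c₀, hw.trans hp' hw', ha, hc⟩

/-- The pieces of a walk in `G` between its inner nodes that remain in `G.reduce S T` are edges of
that graph, up to loops. -/
theorem walk_reducedEdge_of_walk (hG : G.IsSummaryGraph) (hS : S ⊆ G.nodes)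
    (hS' : S' ⊆ (G.reduce S T).nodes) (hT' : T' ⊆ (G.reduce S T).nodes)
    (hST : Disjoint (S ∪ S') (T ∪ T')) (hi : i ∈ G.nodes \ (S ∪ T)) (hk : k ∈ G.nodes \ (S ∪ T))
    (h : Walk G.MarkedEdge (G.condClosure (S ∪ S')) (T ∪ T') i a k b) :
    Walk (G.ReducedEdge S T) ((G.reduce S T).condClosure S') T'
      i (seenMark (G.condClosure S) i a) k (seenMark (G.condClosure S) k b) := by
  have hSS' : S ∪ S' ⊆ G.nodes := Set.union_subset hS fun x hx =>
    (nodes_reduce hG hS T ▸ hS' hx :).1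
  have hopen : S ∪ S' ∪ G.ancestors (S ∪ S') ⊆ G.condClosure (S ∪ S') := fun x hx =>
    hx.elim (fun h => subset_condClosure h) Or.inr
  rw [condClosure_reduce hG hS hS']
  refine ((walk_condClosure hG hST h).factor (G.condClosure S) T).mapMarks
    (N := G.nodes \ (S ∪ T)) (seenMark (G.condClosure S))
    (fun i a k b hi hk hw => ⟨hi, hk, a, b, hw, rfl, rfl⟩) (fun m x m' hp => ?_) hi hk
  have hR : ((S ∪ S' ∪ G.ancestors (S ∪ S')) \ (T ∪ T')) \ G.condClosure S ⊆
      G.condClosure (S ∪ S') \ (S ∪ T) := fun x ⟨⟨hx, hxT⟩, hxR⟩ =>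
    ⟨hopen hx, fun h => h.elim (fun h => hxR (subset_condClosure h)) fun h => hxT (Or.inl h)⟩
  have hT : (T ∪ T') \ T ⊆ T' := fun x hx => hx.1.resolve_left hx.2
  have hx : x ∈ G.nodes \ (S ∪ T) := by
    rcases hp.mem_union with hx | hx
    · exact ⟨condClosure_subset_nodes hG hSS' (hR hx).1, (hR hx).2⟩
    · exact nodes_reduce hG hS T ▸ hT' (hT hx)
  exact ⟨hx, (hp.seenMark Set.disjoint_sdiff_right).mono hR hT⟩

theorem exists_walk_reduce_of_walk (hG : G.IsSummaryGraph) (hS : S ⊆ G.nodes)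
    (hS' : S' ⊆ (G.reduce S T).nodes) (hT' : T' ⊆ (G.reduce S T).nodes)
    (hST : Disjoint (S ∪ S') (T ∪ T')) (hi : i ∈ G.nodes \ (S ∪ T)) (hk : k ∈ G.nodes \ (S ∪ T))
    (hne : i ≠ k) (h : Walk G.MarkedEdge (G.condClosure (S ∪ S')) (T ∪ T') i a k b) :
    ∃ a' b', Walk (G.reduce S T).MarkedEdge ((G.reduce S T).condClosure S') T' i a' k b' ∧
      (i ∈ (G.reduce S T).condClosure S' ∪ T' ∨ a' = seenMark (G.condClosure S) i a) ∧
      (k ∈ (G.reduce S T).condClosure S' ∪ T' ∨ b' = seenMark (G.condClosure S) k b) := by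
  have hloop {x a b} (h : G.ReducedEdge S T x a x b) :
      x ∈ (G.reduce S T).condClosure S' ∨ a = true ∨ b = true := by
    obtain ⟨hx, -, a₀, b₀, hw, rfl, rfl⟩ := h
    by_cases hxR : x ∈ G.condClosure S
    · rw [condClosure_reduce hG hS hS']
      exact Or.inl ⟨condClosure_mono hG Set.subset_union_left hxR, hx.2⟩
    · simpa only [seenMark_of_notMem hxR] using Or.inr
        (((isAncestral_condClosure hG S).mem_or_head_of_closed_walk hG hw).resolve_left hxR)
  obtain ⟨a', b', hw, hab⟩ := ((walk_reducedEdge_of_walk hG hS hS' hT' hST hi hk h).erase_loops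
    fun _ _ _ => hloop).resolve_left hne
  exact ⟨a', b', hw.bind (fun _ _ _ _ he => .edge ((markedEdge_reduce hG hS).2 he))
    subset_rfl subset_rfl, hab⟩

theorem reduce_reduce (hG : G.IsSummaryGraph) (hS : S ⊆ G.nodes)
    (hS' : S' ⊆ (G.reduce S T).nodes) (hT' : T' ⊆ (G.reduce S T).nodes)
    (hST : Disjoint (S ∪ S') (T ∪ T')) :
    (G.reduce S T).reduce S' T' = G.reduce (S ∪ S') (T ∪ T') := by
  have hG' := isSummaryGraph_reduce hG hS T
  have hR' := condClosure_reduce hG hS hS'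
  have hN := nodes_reduce hG hS T
  have hSS' : S ∪ S' ⊆ G.nodes := Set.union_subset hS fun x hx => (hN ▸ hS' hx :).1
  have hset : S ∪ S' ∪ (T ∪ T') = S ∪ T ∪ (S' ∪ T') := Set.union_union_union_comm _ _ _ _
  have hv : (G.reduce S T).newV S' T' = G.newV (S ∪ S') (T ∪ T') := by
    rw [newV_eq hG', newV_eq hG, hR', Set.sdiff_sdiff, hset]
  have hseen {x} (hx : x ∈ G.nodes \ (S ∪ T)) (m) :
      seenMark ((G.reduce S T).condClosure S') x (seenMark (G.condClosure S) x m) =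
        seenMark (G.condClosure (S ∪ S')) x m := by
    have hiff : x ∈ (G.reduce S T).condClosure S' ↔ x ∈ G.condClosure (S ∪ S') := by
      rw [hR', Set.mem_sdiff, and_iff_left hx.2]
    rw [seenMark_congr hiff, seenMark_seenMark
      fun h => condClosure_mono hG Set.subset_union_left h]
  refine ext_markedEdge ?_ hv fun i a k b => ?_
  · change (G.reduce S T).newU S' T' = G.newU (S ∪ S') (T ∪ T')
    rw [newU, newU, hv, hN, Set.sdiff_sdiff, hset, Set.union_assoc (S ∪ T)]
  rw [markedEdge_reduce hG' hS', markedEdge_reduce hG hSS', ReducedEdge, ReducedEdge, hN,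
    Set.sdiff_sdiff, hset]
  refine and_congr_right fun hne => and_congr_right fun hi => and_congr_right fun hk => ?_
  have hsub : G.nodes \ (S ∪ T ∪ (S' ∪ T')) ⊆ G.nodes \ (S ∪ T) :=
    Set.sdiff_subset_sdiff_right Set.subset_union_left
  have hseen' {x m m'} (hx : x ∈ G.nodes \ (S ∪ T ∪ (S' ∪ T')))
      (h : x ∈ (G.reduce S T).condClosure S' ∪ T' ∨ m' = seenMark (G.condClosure S) x m) :
      seenMark ((G.reduce S T).condClosure S') x m' = seenMark (G.condClosure (S ∪ S')) x m := by
    rw [← hseen (hsub hx)]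
    exact seenMark_eq_of_mem_or_eq (h.imp_left (·.resolve_right fun h => hx.2 (Or.inr (Or.inr h))))
  constructor
  · rintro ⟨_, _, h, rfl, rfl⟩
    obtain ⟨a₀, b₀, hw, rfl, rfl⟩ := exists_walk_of_walk_reduce hG hS hS' h
    exact ⟨a₀, b₀, hw, (hseen (hsub hi) a₀).symm, (hseen (hsub hk) b₀).symm⟩
  · rintro ⟨a₀, b₀, h, rfl, rfl⟩
    obtain ⟨a', b', hw, ha, hb⟩ :=
      exists_walk_reduce_of_walk hG hS hS' hT' hST (hsub hi) (hsub hk) hne h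
    exact ⟨a', b', hw, hseen' hi ha, hseen' hk hb⟩

theorem condClosure_empty (G : MixedGraph V) : G.condClosure ∅ = G.v := by
  simp [condClosure, ancestors]

theorem IsSummaryGraph.seenMark_v (hG : G.IsSummaryGraph) (h : G.MarkedEdge i a k b) :
    seenMark G.v k b = b := by
  by_cases hk : k ∈ G.v
  · rw [seenMark_of_mem hk]
    exact (Bool.eq_false_iff.2 fun hb =>
      hG.disjoint.notMem_of_mem_left (hG.mem_u_of_head (hb ▸ h)) hk).symm
  · exact seenMark_of_notMem hk b

theorem reduce_empty (hG : G.IsSummaryGraph) : G.reduce ∅ ∅ = G := by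
  have hv : (G.reduce ∅ ∅).v = G.v := by
    rw [reduce, retype, newV_eq hG, condClosure_empty, Set.union_empty, Set.sdiff_empty]
  have hwalk {i a k b} : Walk G.MarkedEdge G.v ∅ i a k b ↔ G.MarkedEdge i a k b := by
    refine ⟨fun h => ?_, .edge⟩
    rw [← condClosure_empty] at h
    exact ((walk_condClosure hG (Set.disjoint_empty ∅) h).mono (by simp [ancestors])
      subset_rfl).edge_of_empty
  refine ext_markedEdge ?_ hv fun i a k b => ?_
  · ext x
    have hx := hG.disjoint.notMem_of_mem_left (a := x)
    simp only [reduce, retype, newU_eq hG, condClosure_empty, nodes, Set.mem_sdiff, Set.mem_union,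
      Set.mem_empty_iff_false]
    tauto
  simp only [markedEdge_reduce hG (Set.empty_subset _), ReducedEdge, condClosure_empty, hwalk,
    Set.union_empty, Set.sdiff_empty]
  constructor
  · rintro ⟨-, -, -, a₀, b₀, h, rfl, rfl⟩
    rwa [hG.seenMark_v h, hG.seenMark_v (hG.isSymm _ _ _ _ h)]
  · intro h
    have h' := hG.isSymm _ _ _ _ h
    exact ⟨hG.markedEdge_ne h, hG.mem_nodes_right h', hG.mem_nodes_right h, a, b, h,
      hG.seenMark_v h', hG.seenMark_v h⟩

end Iterate

theorem IsSymm.markedEdge_condStep {G : MixedGraph V} (hG : G.IsSymm) (X : Set V) (x i k : V)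
    (a b : Bool) : (G.condStep X x).MarkedEdge i a k b ↔ G.MarkedEdge i a k b ∨
      (i ≠ k ∧ i ∉ X ∧ k ∉ X ∧ x ∉ X ∧ G.MarkedEdge i a x true ∧ G.MarkedEdge x true k b) := by
  have hd : G.dashed k x ↔ G.dashed x k := ⟨hG k true x true, hG x true k true⟩
  cases a <;> cases b <;> simp only [MarkedEdge, condStep]
  rw [hd, ne_comm]
  tauto

theorem IsSymm.markedEdge_margStep {G : MixedGraph V} (hG : G.IsSymm) (X T : Set V) (i k : V)
    (a b : Bool) : (G.margStep X T).MarkedEdge i a k b ↔ G.MarkedEdge i a k b ∨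
      (i ≠ k ∧ i ∉ X ∧ k ∉ X ∧ ∃ t ∈ T, t ∉ X ∧ ∃ m m', (m = false ∨ m' = false) ∧
        G.MarkedEdge i a t m ∧ G.MarkedEdge t m' k b) := by
  have hd (i k) : G.dashed i k ↔ G.dashed k i := ⟨hG i true k true, hG k true i true⟩
  have hf (i k) : G.full i k ↔ G.full k i := ⟨hG i false k false, hG k false i false⟩
  have hex (P : Bool → Bool → Prop) : (∃ m m', (m = false ∨ m' = false) ∧ P m m') ↔
      P false false ∨ P false true ∨ P true false := by
    simp only [Bool.exists_bool]; tauto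
  cases a <;> cases b <;> simp only [hex, MarkedEdge, margStep]
  · have hflip (t) : (G.arrow k t ∧ G.full t i ∨ G.arrow k t ∧ G.arrow t i ∨
        G.dashed k t ∧ G.full t i) ↔ (G.full i t ∧ G.arrow k t ∨ G.full i t ∧ G.dashed t k ∨
          G.arrow t i ∧ G.arrow k t) := by
      rw [hf t i, hd k t]; tauto
    simp only [hflip, ne_comm (a := k), and_left_comm (a := k ∉ X)]

theorem IsSymm.condStep {G : MixedGraph V} (hG : G.IsSymm) (X : Set V) (x : V) :
    (G.condStep X x).IsSymm := fun i a k b h => by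
  rw [hG.markedEdge_condStep] at h ⊢
  exact h.imp (hG _ _ _ _) fun ⟨hne, hi, hk, hx, h, h'⟩ =>
    ⟨hne.symm, hk, hi, hx, hG _ _ _ _ h', hG _ _ _ _ h⟩

theorem IsSymm.margStep {G : MixedGraph V} (hG : G.IsSymm) (X T : Set V) :
    (G.margStep X T).IsSymm := fun i a k b h => by
  rw [hG.markedEdge_margStep] at h ⊢
  exact h.imp (hG _ _ _ _) fun ⟨hne, hi, hk, t, ht, htX, m, m', hm, h, h'⟩ =>
    ⟨hne.symm, hk, hi, t, ht, htX, m', m, hm.symm, hG _ _ _ _ h', hG _ _ _ _ h⟩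

/-- The edges of `K` outside `X` trace the walks of `G` with inner collision nodes in `R` and inner
transmitting nodes in `T`. The mark of a walk at an end in `R` is not recorded: such an end can be
reached with either mark, and re-typing will forget it. -/
structure Represents (K G : MixedGraph V) (R T X : Set V) : Prop where
  isSymm : K.IsSymm
  ne : ∀ {i a k b}, K.MarkedEdge i a k b → i ≠ k
  sound : ∀ {i a k b}, K.MarkedEdge i a k b → Walk G.MarkedEdge R T i a k b
  complete : ∀ {i a k b}, i ≠ k → i ∉ X → k ∉ X → Walk G.MarkedEdge R T i a k b →
    ∃ a' b', K.MarkedEdge i a' k b' ∧ (i ∈ R ∨ a' = a) ∧ (k ∈ R ∨ b' = b)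

theorem IsSummaryGraph.represents {G : MixedGraph V} (hG : G.IsSummaryGraph) :
    G.Represents G ∅ ∅ ∅ where
  isSymm := hG.isSymm
  ne := hG.markedEdge_ne
  sound := .edge
  complete _ _ _ h := ⟨_, _, h.edge_of_empty, .inr rfl, .inr rfl⟩

namespace Represents

variable {K G : MixedGraph V} {R S T X : Set V} {x : V}

theorem condStep (h : K.Represents G R T X) (hx : x ∉ X) :
    (K.condStep X x).Represents G (insert x R) T X where
  isSymm := h.isSymm.condStep X x
  ne he := ((h.isSymm.markedEdge_condStep ..).1 he).elim h.ne (·.1)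
  sound he := by
    have hw {i a k b} (he : K.MarkedEdge i a k b) : Walk G.MarkedEdge (insert x R) T i a k b :=
      (h.sound he).mono (Set.subset_insert x R) subset_rfl
    rcases (h.isSymm.markedEdge_condStep ..).1 he with he | ⟨-, -, -, -, he, he'⟩
    · exact hw he
    · exact (hw he).trans (Or.inl ⟨rfl, rfl, Set.mem_insert x R⟩) (hw he')
  complete {i a k b} hne hi hk hw := by
    simp only [h.isSymm.markedEdge_condStep, Set.mem_insert_iff]
    have keep {a b} (hw : Walk G.MarkedEdge R T i a k b) : ∃ a' b',
        K.MarkedEdge i a' k b' ∧ ((i = x ∨ i ∈ R) ∨ a' = a) ∧ ((k = x ∨ k ∈ R) ∨ b' = b) :=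
      have ⟨a', b', he, ha, hb⟩ := h.complete hne hi hk hw
      ⟨a', b', he, ha.imp_left .inr, hb.imp_left .inr⟩
    rcases hw.split_collision with hw | ⟨hw, hw'⟩
    · obtain ⟨a', b', he, hab⟩ := keep hw
      exact ⟨a', b', .inl he, hab⟩
    by_cases hix : i = x
    · obtain ⟨a', b', he, -, hb⟩ := keep (hix ▸ hw')
      exact ⟨a', b', .inl he, .inl (.inl hix), hb⟩
    by_cases hkx : k = x
    · obtain ⟨a', b', he, ha, -⟩ := keep (hkx ▸ hw)
      exact ⟨a', b', .inl he, ha, .inl (.inl hkx)⟩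
    by_cases hxR : x ∈ R
    · obtain ⟨a', b', he, hab⟩ := keep (hw.trans (.inl ⟨rfl, rfl, hxR⟩) hw')
      exact ⟨a', b', .inl he, hab⟩
    obtain ⟨a', m, he, ha, hm⟩ := h.complete hix hi hx hw
    obtain ⟨m', b', he', hm', hb⟩ := h.complete (Ne.symm hkx) hx hk hw'
    obtain rfl := hm.resolve_left hxR
    obtain rfl := hm'.resolve_left hxR
    exact ⟨a', b', .inr ⟨hne, hi, hk, hx, he, he'⟩, ha.imp_left .inr, hb.imp_left .inr⟩

theorem condSteps (h : K.Represents G R T X) {L : List V} (hL : ∀ x ∈ L, x ∉ X) :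
    (K.condSteps X L).Represents G (R ∪ {x | x ∈ L}) T X := by
  induction L generalizing K R with
  | nil => simpa [MixedGraph.condSteps] using h
  | cons x L ih =>
    have hset : R ∪ {y | y ∈ x :: L} = insert x R ∪ {y | y ∈ L} := by
      ext y
      simp only [List.mem_cons, Set.mem_union, Set.mem_ofPred_eq, Set.mem_insert_iff]
      tauto
    rw [hset]
    exact ih (h.condStep (hL x List.mem_cons_self)) fun y hy => hL y (List.mem_cons_of_mem x hy)

theorem margStep (h : K.Represents G R ∅ ∅) (hG : G.IsSummaryGraph)
    (hR : ∀ i k, G.arrow i k → i ∈ R → k ∈ R) (hT : T.Subsingleton) (hX : Disjoint X T) :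
    (K.margStep X T).Represents G R T (X ∪ T) where
  isSymm := h.isSymm.margStep X T
  ne he := ((h.isSymm.markedEdge_margStep ..).1 he).elim h.ne (·.1)
  sound he := by
    have hw {i a k b} (he : K.MarkedEdge i a k b) : Walk G.MarkedEdge R T i a k b :=
      (h.sound he).mono subset_rfl (Set.empty_subset T)
    rcases (h.isSymm.markedEdge_margStep ..).1 he with he | ⟨-, -, -, t, ht, -, m, m', hm, he, he'⟩
    · exact hw he
    · exact (hw he).trans (Or.inr ⟨hm, ht⟩) (hw he')
  complete {i a k b} hne hi hk hw := by
    simp only [h.isSymm.markedEdge_margStep]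
    have trace {i a k b} (hne : i ≠ k) := @h.complete i a k b hne (Set.notMem_empty i)
      (Set.notMem_empty k)
    rcases hw.split_transmission hT fun t _ => hG.mem_of_closed_walk hR with
      hw | ⟨t, ht, m, m', hw, hp, hw'⟩
    · obtain ⟨a', b', he, hab⟩ := trace hne hw
      exact ⟨a', b', .inl he, hab⟩
    obtain ⟨a', n, he, ha, hn⟩ := trace (fun hit : i = t => hi (.inr (hit ▸ ht))) hw
    obtain ⟨n', b', he', hn', hb⟩ := trace (fun htk : t = k => hk (.inr (htk ▸ ht))) hw'
    by_cases hnn' : n = false ∨ n' = false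
    · exact ⟨a', b', .inr ⟨hne, fun h => hi (.inl h), fun h => hk (.inl h), t, ht,
        hX.notMem_of_mem_right ht, n, n', hnn', he, he'⟩, ha, hb⟩
    obtain ⟨rfl, rfl⟩ : n = true ∧ n' = true := by simpa using hnn'
    have htR : t ∈ R := by
      by_contra htR
      obtain rfl := hn.resolve_left htR
      obtain rfl := hn'.resolve_left htR
      simp [Passes, htR] at hp
    obtain ⟨a₁, b₁, he₁, ha₁, hb₁⟩ :=
      trace hne ((h.sound he).trans (.inl ⟨rfl, rfl, htR⟩) (h.sound he'))
    exact ⟨a₁, b₁, .inl he₁, ha.elim .inl (· ▸ ha₁), hb.elim .inl (· ▸ hb₁)⟩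

theorem retype_eq_reduce (h : K.Represents G R T X) (hG : G.IsSummaryGraph) (hS : S ⊆ G.nodes)
    (hST : Disjoint S T) (hSR : (S ∪ G.ancestors S) \ T ⊆ R) (hR : R ⊆ G.condClosure S)
    (hX : X ⊆ S ∪ T) : retype (G.newU S T) (G.newV S T) K = G.reduce S T := by
  refine ext_markedEdge rfl rfl fun i a k b => ?_
  rw [markedEdge_retype_of_sound hG hS h.isSymm fun _ _ _ _ he =>
    (h.sound he).mono hR subset_rfl, markedEdge_reduce hG hS]
  constructor
  · rintro ⟨hi, hk, a₀, b₀, he, hab⟩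
    exact ⟨h.ne he, hi, hk, a₀, b₀, (h.sound he).mono hR subset_rfl, hab⟩
  · rintro ⟨hne, hi, hk, a₀, b₀, hw, rfl, rfl⟩
    obtain ⟨a', b', he, ha, hb⟩ := h.complete hne (fun hiX => hi.2 (hX hiX))
      (fun hkX => hk.2 (hX hkX)) ((walk_condClosure hG hST hw).mono hSR subset_rfl)
    exact ⟨hi, hk, a', b', he, seenMark_eq_of_mem_or_eq (ha.imp_left (@hR i)),
      seenMark_eq_of_mem_or_eq (hb.imp_left (@hR k))⟩

end Represents

section Generates

variable {G H : MixedGraph V} {S T : Set V}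

theorem retype_condSteps_margStep (hG : G.IsSummaryGraph) (hS : S ⊆ G.nodes)
    (hT : T.Subsingleton) (hST : Disjoint S T) {L : List V}
    (hL : ∀ a, a ∈ L ↔ a ∈ (S ∪ G.ancestors S) \ T) :
    retype (G.newU S T) (G.newV S T) (condSteps T (margStep ∅ T G) L) = G.reduce S T := by
  have hmarg : (margStep ∅ T G).Represents G ∅ T T := by
    simpa using hG.represents.margStep hG (by simp) hT (Set.empty_disjoint T)
  have hcond : (condSteps T (margStep ∅ T G) L).Represents G ((S ∪ G.ancestors S) \ T) T T := by
    simpa only [Set.empty_union, hL, Set.ofPred_mem_eq] using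
      hmarg.condSteps fun x hx => ((hL x).1 hx).2
  refine hcond.retype_eq_reduce hG hS hST subset_rfl ?_ Set.subset_union_right
  exact Set.sdiff_subset.trans (Set.union_subset subset_condClosure Set.subset_union_right)

theorem retype_margStep_condSteps (hG : G.IsSummaryGraph) (hS : S ⊆ G.nodes)
    (hT : T.Subsingleton) (hST : Disjoint S T) {L : List V}
    (hL : ∀ a, a ∈ L ↔ a ∈ S ∪ G.ancestors S) :
    retype (G.newU S T) (G.newV S T) (margStep S T (condSteps ∅ G L)) = G.reduce S T := by
  have hcond : (condSteps ∅ G L).Represents G (S ∪ G.ancestors S) ∅ ∅ := by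
    simpa only [Set.empty_union, hL, Set.ofPred_mem_eq] using
      hG.represents.condSteps (L := L) fun x _ => Set.notMem_empty x
  have hparent (i k) (h : G.arrow i k) : i ∈ S ∪ G.ancestors S → k ∈ S ∪ G.ancestors S := by
    rintro (hi | ⟨s, hs, hi⟩)
    exacts [.inr ⟨i, hi, .single h⟩, .inr ⟨s, hs, .head h hi⟩]
  exact (hcond.margStep hG hparent hT hST).retype_eq_reduce hG hS hST Set.sdiff_subset
    (Set.union_subset subset_condClosure Set.subset_union_right) subset_rfl

theorem finite_union_ancestors (hG : G.IsSummaryGraph) (hfin : G.nodes.Finite)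
    (hS : S ⊆ G.nodes) : (S ∪ G.ancestors S).Finite :=
  hfin.subset (Set.union_subset hS (hG.ancestors_subset S))

theorem generates_iff (hG : G.IsSummaryGraph) (hfin : G.nodes.Finite) (hS : S ⊆ G.nodes)
    (hT : T.Subsingleton) (hST : Disjoint S T) : G.Generates S T H ↔ H = G.reduce S T := by
  constructor
  · rintro ⟨L, hL, rfl⟩
    exact retype_condSteps_margStep hG hS hT hST hL
  · rintro rfl
    have hL := ((finite_union_ancestors hG hfin hS).sdiff (t := T))
    exact ⟨hL.toFinset.toList, by simp, (retype_condSteps_margStep hG hS hT hST (by simp)).symm⟩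

theorem generatesCondFirst_iff (hG : G.IsSummaryGraph) (hfin : G.nodes.Finite) (hS : S ⊆ G.nodes)
    (hT : T.Subsingleton) (hST : Disjoint S T) :
    G.GeneratesCondFirst S T H ↔ H = G.reduce S T := by
  constructor
  · rintro ⟨L, hL, rfl⟩
    exact retype_margStep_condSteps hG hS hT hST hL
  · rintro rfl
    have hL := finite_union_ancestors hG hfin hS
    exact ⟨hL.toFinset.toList, by simp, (retype_margStep_condSteps hG hS hT hST (by simp)).symm⟩

theorem exists_generates_generates_iff {S' T' : Set V} (hG : G.IsSummaryGraph)
    (hfin : G.nodes.Finite) (hS : S ⊆ G.nodes) (hT : T.Subsingleton)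
    (hS' : S' ⊆ (G.reduce S T).nodes) (hT' : T' ⊆ (G.reduce S T).nodes) (hT₁ : T'.Subsingleton)
    (hST : Disjoint (S ∪ S') (T ∪ T')) :
    (∃ K, G.Generates S T K ∧ K.Generates S' T' H) ↔ H = G.reduce (S ∪ S') (T ∪ T') := by
  have hfin' : (G.reduce S T).nodes.Finite :=
    hfin.subset (nodes_reduce hG hS T ▸ Set.sdiff_subset)
  simp only [generates_iff hG hfin hS hT
      (hST.mono Set.subset_union_left Set.subset_union_left), exists_eq_left,
    generates_iff (isSummaryGraph_reduce hG hS T) hfin' hS' hT₁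
      (hST.mono Set.subset_union_right Set.subset_union_right),
    reduce_reduce hG hS hS' hT' hST]

end Generates

section GeneratesList

variable {G H : MixedGraph V} {o : Op V} {ops : List (Op V)}

theorem generatesList_cons_iff : GeneratesList G (o :: ops) H ↔
    ∃ K, G.Generates (condSet [o]) (margSet [o]) K ∧ GeneratesList K ops H := by
  cases o with
  | condition s =>
    have hc : condSet [Op.condition s] = {s} := by ext; simp [condSet]
    have hm : margSet [Op.condition s] = ∅ := by ext; simp [margSet]
    rw [hc, hm]
    refine ⟨?_, fun ⟨K, h, h'⟩ => .condition h h'⟩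
    rintro (_ | ⟨h, h'⟩ | _)
    exact ⟨_, h, h'⟩
  | marginalise t =>
    have hc : condSet [Op.marginalise t] = ∅ := by ext; simp [condSet]
    have hm : margSet [Op.marginalise t] = {t} := by ext; simp [margSet]
    rw [hc, hm]
    refine ⟨?_, fun ⟨K, h, h'⟩ => .marginalise h h'⟩
    rintro (_ | _ | ⟨h, h'⟩)
    exact ⟨_, h, h'⟩

theorem condSet_cons (o : Op V) (ops : List (Op V)) :
    condSet (o :: ops) = condSet [o] ∪ condSet ops := by
  ext; simp [condSet]

theorem margSet_cons (o : Op V) (ops : List (Op V)) :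
    margSet (o :: ops) = margSet [o] ∪ margSet ops := by
  ext; simp [margSet]

theorem subsingleton_margSet_singleton (o : Op V) : (margSet [o]).Subsingleton :=
  fun _ ht _ ht' =>
    Op.marginalise.inj ((List.mem_singleton.1 ht).trans (List.mem_singleton.1 ht').symm)

theorem condSet_union_margSet (ops : List (Op V)) :
    condSet ops ∪ margSet ops = {x | ∃ o ∈ ops, o.node = x} := by
  ext x
  constructor
  · rintro (h | h)
    exacts [⟨_, h, rfl⟩, ⟨_, h, rfl⟩]
  · rintro ⟨_ | _, h, rfl⟩
    exacts [.inl h, .inr h]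

theorem disjoint_condSet_margSet (h : (ops.map Op.node).Nodup) :
    Disjoint (condSet ops) (margSet ops) := by
  refine Set.disjoint_left.2 fun x hx hx' => ?_
  cases List.inj_on_of_nodup_map h hx hx' rfl

theorem generatesList_iff (hG : G.IsSummaryGraph) (hfin : G.nodes.Finite)
    (hnd : (ops.map Op.node).Nodup) (hops : ∀ o ∈ ops, o.node ∈ G.nodes) :
    GeneratesList G ops H ↔ H = G.reduce (condSet ops) (margSet ops) := by
  induction ops generalizing G with
  | nil =>
    have hc : condSet ([] : List (Op V)) = ∅ := by ext; simp [condSet]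
    have hm : margSet ([] : List (Op V)) = ∅ := by ext; simp [margSet]
    rw [hc, hm, reduce_empty hG]
    refine ⟨?_, fun h => h ▸ .nil G⟩
    rintro ⟨⟩
    rfl
  | cons o ops ih =>
    have hdisj := disjoint_condSet_margSet hnd
    rw [condSet_cons, margSet_cons] at hdisj
    have hS : condSet [o] ⊆ G.nodes := fun s hs =>
      hops (.condition s) (List.mem_singleton.1 hs ▸ List.mem_cons_self)
    have hN : (G.reduce (condSet [o]) (margSet [o])).nodes = G.nodes \ {o.node} := by
      rw [nodes_reduce hG hS, condSet_union_margSet]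
      simp [eq_comm]
    have hops' : ∀ o' ∈ ops, o'.node ∈ (G.reduce (condSet [o]) (margSet [o])).nodes := by
      intro o' ho'
      rw [hN]
      refine ⟨hops o' (List.mem_cons_of_mem o ho'), fun ho => ?_⟩
      exact (List.nodup_cons.1 hnd).1 (Set.mem_singleton_iff.1 ho ▸ List.mem_map_of_mem ho')
    rw [generatesList_cons_iff]
    simp only [generates_iff hG hfin hS (subsingleton_margSet_singleton o)
      (hdisj.mono Set.subset_union_left Set.subset_union_left), exists_eq_left]
    rw [ih (isSummaryGraph_reduce hG hS _) (hfin.subset (hN ▸ Set.sdiff_subset))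
      (List.nodup_cons.1 hnd).2 hops', condSet_cons o ops, margSet_cons o ops,
      reduce_reduce hG hS (S' := condSet ops) (T' := margSet ops)
        (fun x hx => hops' (.condition x) hx) (fun x hx => hops' (.marginalise x) hx) hdisj]

end GeneratesList

section Independence

variable {G : MixedGraph V} {R S T c : Set V} {i k : V} {a b : Bool} {n : ℕ} {x : ℕ → V}
  {e : ℕ → EdgeType}

/-- The mark of an edge at its left node. -/
def EdgeType.leftMark : EdgeType → Bool
  | .left => true
  | .right => false
  | .dashed => true
  | .full => false

/-- The mark of an edge at its right node. -/
def EdgeType.rightMark : EdgeType → Bool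
  | .left => false
  | .right => true
  | .dashed => true
  | .full => false

theorem hasEdge_iff (f : EdgeType) (i k : V) :
    G.HasEdge f i k ↔ G.MarkedEdge i f.leftMark k f.rightMark := by
  cases f <;> rfl

theorem isCollision_iff (f g : EdgeType) :
    IsCollision f g ↔ f.rightMark = true ∧ g.leftMark = true := by
  cases f <;> cases g <;> simp [IsCollision, EdgeType.leftMark, EdgeType.rightMark]

theorem exists_edgeType (a b : Bool) : ∃ f : EdgeType, f.leftMark = a ∧ f.rightMark = b := by
  cases a <;> cases b
  exacts [⟨.full, rfl, rfl⟩, ⟨.right, rfl, rfl⟩, ⟨.left, rfl, rfl⟩, ⟨.dashed, rfl, rfl⟩]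

/-- A walk as a sequence of nodes `x 0, …, x (n + 1)` and edges `e 0, …, e n`, with inner collision
nodes in `R` and inner transmitting nodes in `T`. -/
structure IsWalkSeq (G : MixedGraph V) (R T : Set V) (n : ℕ) (x : ℕ → V) (e : ℕ → EdgeType) :
    Prop where
  edge : ∀ j ≤ n, G.MarkedEdge (x j) (e j).leftMark (x (j + 1)) (e j).rightMark
  passes : ∀ j < n, Passes R T (e j).rightMark (x (j + 1)) (e (j + 1)).leftMark

namespace IsWalkSeq

theorem of_le (h : G.IsWalkSeq R T n x e) {p : ℕ} (hp : p ≤ n) : G.IsWalkSeq R T p x e :=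
  ⟨fun j hj => h.edge j (hj.trans hp), fun j hj => h.passes j (hj.trans_le hp)⟩

theorem walk (h : G.IsWalkSeq R T n x e) {p : ℕ} (d : ℕ) (hp : p + d ≤ n) :
    Walk G.MarkedEdge R T (x p) (e p).leftMark (x (p + d + 1)) (e (p + d)).rightMark := by
  induction d with
  | zero => exact .edge (h.edge p hp)
  | succ d ih => exact .step (ih (by lia)) (h.passes (p + d) (by lia)) (h.edge _ hp)

theorem snoc (h : G.IsWalkSeq R T n x e) {f : EdgeType}
    (hp : Passes R T (e n).rightMark (x (n + 1)) f.leftMark)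
    (hf : G.MarkedEdge (x (n + 1)) f.leftMark k f.rightMark) :
    G.IsWalkSeq R T (n + 1) (Function.update x (n + 2) k) (Function.update e (n + 1) f) where
  edge j hj := by
    rcases hj.lt_or_eq with hj | rfl
    · simpa [Function.update_of_ne, show j ≠ n + 2 by lia, show j + 1 ≠ n + 2 by lia, hj.ne]
        using h.edge j (by lia)
    · simpa using hf
  passes j hj := by
    rcases (Nat.lt_succ_iff.1 hj).lt_or_eq with hj | rfl
    · simpa [Function.update_of_ne, show j ≠ n by lia, show j ≠ n + 1 by lia,
        show j + 1 ≠ n + 2 by lia] using h.passes j hj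
    · simpa using hp

end IsWalkSeq

/-- If the last inner node has been met before, the closed section in between is left out. -/
theorem IsAncestral.exists_isWalkSeq_injOn (hR : G.IsAncestral R) (hG : G.IsSummaryGraph)
    (h : Walk G.MarkedEdge R T i a k b) :
    ∃ n x e, G.IsWalkSeq R T n x e ∧ Set.InjOn x (Set.Ioo 0 (n + 1)) ∧
      x 0 = i ∧ x (n + 1) = k ∧ (e n).rightMark = b := by
  induction h with
  | @edge k b he =>
    obtain ⟨f, rfl, rfl⟩ := exists_edgeType a b
    refine ⟨0, fun j => if j = 0 then i else k, fun _ => f, ⟨?_, by simp⟩, ?_, by simp, by simp,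
      rfl⟩
    · rintro j hj
      obtain rfl := Nat.le_zero.1 hj
      simpa using he
    · rintro p ⟨hp, hp'⟩
      lia
  | @step j k b b' c _ hp he ih =>
    obtain ⟨n, x, e, hx, hinj, rfl, rfl, rfl⟩ := ih
    obtain ⟨f, rfl, rfl⟩ := exists_edgeType b' c
    suffices ∃ p ≤ n, Set.InjOn x (Set.Ioo 0 (p + 2)) ∧ x (p + 1) = x (n + 1) ∧
        Passes R T (e p).rightMark (x (p + 1)) f.leftMark by
      obtain ⟨p, hpn, hinj, hxp, hp⟩ := this
      refine ⟨p + 1, _, _, (hx.of_le hpn).snoc hp (hxp ▸ he), ?_, by simp, by simp, by simp⟩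
      refine hinj.congr fun l hl => ?_
      simp [Function.update_of_ne hl.2.ne]
    by_cases hrep : ∃ p < n, x (p + 1) = x (n + 1)
    · obtain ⟨p, hpn, hxp⟩ := hrep
      have loop := hx.walk (p := p + 1) (n - (p + 1)) (by lia)
      rw [show p + 1 + (n - (p + 1)) = n by lia, ← hxp] at loop
      refine ⟨p, hpn.le, hinj.mono (Set.Ioo_subset_Ioo_right (by lia)), hxp, ?_⟩
      exact (hx.passes p hpn).of_loop (hR.mem_or_head_of_closed_walk hG loop) (hxp ▸ hp)
    · push Not at hrep
      refine ⟨n, le_rfl, ?_, rfl, hp⟩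
      have : Set.Ioo 0 (n + 2) = insert (n + 1) (Set.Ioo 0 (n + 1)) := by
        ext l
        simp only [Set.mem_Ioo, Set.mem_insert_iff]
        lia
      rw [this, Set.injOn_insert (by simp)]
      refine ⟨hinj, ?_⟩
      rintro ⟨l, ⟨hl, hl'⟩, hxl⟩
      exact hrep (l - 1) (by lia) (by rwa [Nat.sub_add_cancel hl])

theorem isActivePath_iff (hG : G.IsSummaryGraph) :
    G.IsActivePath c (n + 1) x e ↔
      G.IsWalkSeq (G.condClosure c) (G.nodes \ c) n x e ∧ Set.InjOn x (Set.Ioo 0 (n + 1)) := by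
  constructor
  · intro h
    have hedge : ∀ j ≤ n, G.MarkedEdge (x j) (e j).leftMark (x (j + 1)) (e j).rightMark :=
      fun j hj => (hasEdge_iff _ _ _).1 (h.edge j (by lia))
    refine ⟨⟨hedge, fun j hj => ?_⟩, h.inner_distinct⟩
    by_cases hc : IsCollision (e j) (e (j + 1))
    · obtain ⟨h₁, h₂⟩ := (isCollision_iff _ _).1 hc
      exact .inl ⟨h₁, h₂, (h.collision j (by lia) hc).imp_left .inr⟩
    · have hmarks : (e j).rightMark = false ∨ (e (j + 1)).leftMark = false := by
        simpa [isCollision_iff, imp_iff_not_or] using hc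
      exact .inr ⟨hmarks, hG.mem_nodes_right (hedge j hj.le), h.transmitting j (by lia) hc⟩
  · rintro ⟨h, hinj⟩
    refine ⟨by lia, fun j hj => (hasEdge_iff _ _ _).2 (h.edge j (by lia)), hinj, ?_, ?_⟩
    · intro j hj hc
      obtain ⟨h₁, h₂⟩ := (isCollision_iff _ _).1 hc
      have hu : x (j + 1) ∈ G.u := hG.mem_u_of_head (h₁ ▸ h.edge j (by lia))
      rcases h.passes j (by lia) with ⟨-, -, (hv | hc) | hanc⟩ | ⟨hmarks, -⟩
      · exact absurd hv (hG.disjoint.notMem_of_mem_left hu)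
      · exact .inl hc
      · exact .inr hanc
      · simp [h₁, h₂] at hmarks
    · intro j hj hc
      rcases h.passes j (by lia) with ⟨h₁, h₂, -⟩ | ⟨-, -, hxc⟩
      exacts [absurd ((isCollision_iff _ _).2 ⟨h₁, h₂⟩) hc, hxc]

theorem implies_iff (hG : G.IsSummaryGraph) (α β c : Set V) :
    G.Implies α β c ↔ ∀ i ∈ α, ∀ k ∈ β, ∀ a b,
      ¬ Walk G.MarkedEdge (G.condClosure c) (G.nodes \ c) i a k b := by
  constructor
  · intro h i hi k hk a b hw
    obtain ⟨n, x, e, hx, hinj, h0, hn, -⟩ :=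
      (isAncestral_condClosure hG c).exists_isWalkSeq_injOn hG hw
    exact h ⟨i, hi, k, hk, n + 1, x, e, (isActivePath_iff hG).2 ⟨hx, hinj⟩, h0, hn⟩
  · rintro h ⟨i, hi, k, hk, n, x, e, hpath, rfl, rfl⟩
    obtain ⟨n, rfl⟩ := Nat.exists_eq_add_one.2 hpath.pos
    have hw := ((isActivePath_iff hG).1 hpath).1.walk (p := 0) n (Nat.zero_add n).le
    rw [Nat.zero_add] at hw
    exact h _ hi _ hk _ _ hw

theorem preservesIndependence_reduce (hG : G.IsSummaryGraph) (hS : S ⊆ G.nodes) (hT : T ⊆ G.nodes)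
    (hST : Disjoint S T) : G.PreservesIndependence S (G.reduce S T) := by
  intro α β c hα hβ hc hαβ _ _
  have hN := nodes_reduce hG hS T
  have hcN := hc
  rw [hN] at hα hβ hc
  have hcT : Disjoint c T := Set.disjoint_left.2 fun x hx hx' => (hc hx).2 (Or.inr hx')
  rw [implies_iff (isSummaryGraph_reduce hG hS T), implies_iff hG, hN, Set.union_comm c S]
  set T' := (G.nodes \ (S ∪ T)) \ c with hT'
  have hTT' : G.nodes \ (S ∪ c) = T ∪ T' := by
    ext x
    have := @hT x
    have := fun h => hST.notMem_of_mem_right (a := x) h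
    have := fun h => hcT.notMem_of_mem_right (a := x) h
    simp only [hT', Set.mem_union, Set.mem_sdiff]
    tauto
  have hdisj : Disjoint (S ∪ c) (T ∪ T') := hTT' ▸ Set.disjoint_sdiff_right
  have hTN : T' ⊆ (G.reduce S T).nodes := hN ▸ Set.sdiff_subset
  rw [hTT']
  refine forall₂_congr fun i hi => forall₂_congr fun k hk => ⟨?_, ?_⟩
  · intro h a b hw
    have ⟨a', b', hw', _⟩ := exists_walk_reduce_of_walk hG hS hcN hTN hdisj (hα hi) (hβ hk)
      (hαβ.ne_of_mem hi hk) hw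
    exact h a' b' hw'
  · intro h a b hw
    have ⟨a', b', hw', _⟩ := exists_walk_of_walk_reduce hG hS hcN hw
    exact h a' b' hw'

end Independence

section PartialClosure

variable {a : Set V} {F : V → V → Prop} {i k l : V}

theorem closure_iff (hi : i ∈ a) :
    closure a F i l ↔ Relation.ReflTransGen (fun x y => y ∈ a ∧ F x y) i l := by
  constructor
  · rintro ⟨-, -, h⟩
    exact Relation.ReflTransGen.mono (fun _ _ h => h.2) _ _ h
  · intro h
    induction h with
    | refl => exact ⟨hi, hi, .refl⟩
    | tail _ h ih => exact ⟨hi, h.1, ih.2.2.tail ⟨ih.2.1, h⟩⟩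

/-- The four blocks of `zer` are the cases of a chain of ones through `a` in which the first and the
last node may or may not be in `a`. -/
theorem zer_iff (hk : F k k) :
    zer a F i k ↔ ∃ l, Relation.ReflTransGen (fun x y => y ∈ a ∧ F x y) i l ∧ F l k := by
  constructor
  · rintro (⟨hi, -, h⟩ | ⟨hi, -, l, h, hl⟩ | ⟨-, -, j, hj, h⟩ | ⟨-, -, h | ⟨j, l, hj, h, hl⟩⟩)
    · exact ⟨k, (closure_iff hi).1 h, hk⟩
    · exact ⟨l, (closure_iff hi).1 h, hl⟩
    · exact ⟨k, .head ⟨h.1, hj⟩ ((closure_iff h.1).1 h), hk⟩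
    · exact ⟨i, .refl, h⟩
    · exact ⟨l, .head ⟨h.1, hj⟩ ((closure_iff h.1).1 h), hl⟩
  · rintro ⟨l, h, hl⟩
    by_cases hka : k ∈ a
    · replace h := h.tail ⟨hka, hl⟩
      by_cases hi : i ∈ a
      · exact .inl ⟨hi, hka, (closure_iff hi).2 h⟩
      · obtain rfl | ⟨j, ⟨hj, hij⟩, h⟩ := h.cases_head
        · exact absurd hka hi
        · exact .inr (.inr (.inl ⟨hi, hka, j, hij, (closure_iff hj).2 h⟩))
    · by_cases hi : i ∈ a
      · exact .inr (.inl ⟨hi, hka, l, (closure_iff hi).2 h, hl⟩)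
      · obtain rfl | ⟨j, ⟨hj, hij⟩, h⟩ := h.cases_head
        · exact .inr (.inr (.inr ⟨hi, hka, .inl hl⟩))
        · exact .inr (.inr (.inr ⟨hi, hka, .inr ⟨j, l, hij, (closure_iff hj).2 h, hl⟩⟩))

end PartialClosure

section DAG

variable {D : MixedGraph V} {C M R T : Set V} {i j k : V} {a b : Bool}

theorem DirectedWalk.cons (h : D.DirectedWalk T j k) (hj : j ∈ T) (he : D.arrow j i) :
    D.DirectedWalk T i k := by
  induction h with
  | edge he' => exact .step (.edge he) hj he'
  | step _ hl he' ih => exact .step ih hl he'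

theorem zer_edgeMatrix_iff : zer T D.edgeMatrix i k ↔ i = k ∨ D.DirectedWalk T k i := by
  rw [zer_iff (F := D.edgeMatrix) (Or.inl rfl)]
  constructor
  · rintro ⟨l, h, hlk⟩
    have hl : l = i ∨ l ∈ T ∧ D.DirectedWalk T l i := by
      clear hlk
      induction h with
      | refl => exact .inl rfl
      | @tail j l _ h ih =>
        obtain ⟨hl, rfl | he⟩ := h
        · exact ih
        · rcases ih with rfl | ⟨hj, ih⟩
          exacts [.inr ⟨hl, .edge he⟩, .inr ⟨hl, ih.cons hj he⟩]
    rcases hlk with rfl | he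
    · exact hl.imp Eq.symm (·.2)
    · rcases hl with rfl | ⟨hl, h⟩
      exacts [.inr (.edge he), .inr (h.cons hl he)]
  · rintro (rfl | h)
    · exact ⟨i, .refl, .inl rfl⟩
    · induction h with
      | @edge i he => exact ⟨i, .refl, .inr he⟩
      | step _ hj he ih =>
        obtain ⟨l, h, hlk⟩ := ih
        exact ⟨l, .head ⟨hj, .inr he⟩ h, hlk⟩

namespace IsDAG

theorem condClosure_eq (hD : D.IsDAG) (C : Set V) : D.condClosure C = C ∪ D.foster C := by
  simp [condClosure, foster, hD.v_empty]

theorem foster_eq (hD : D.IsDAG) (C : Set V) : D.foster C = D.condClosure C \ C := by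
  simp [condClosure, foster, hD.v_empty]

theorem outsiders_eq (hD : D.IsDAG) (C : Set V) : D.outsiders C = D.nodes \ D.condClosure C := by
  rw [outsiders, hD.condClosure_eq]

theorem foster_subset_condClosure (hD : D.IsDAG) (C : Set V) : D.foster C ⊆ D.condClosure C :=
  hD.foster_eq C ▸ Set.sdiff_subset

theorem foster_inter (hD : D.IsDAG) (hCM : Disjoint C M) :
    D.foster C ∩ M = D.condClosure C ∩ M := by
  rw [hD.foster_eq]
  grind

theorem mem_foster (hD : D.IsDAG) (hCM : Disjoint C M) (hi : i ∈ D.condClosure C ∩ M) :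
    i ∈ D.foster C :=
  (hD.foster_inter hCM ▸ hi).1

theorem right_mark_eq_not (hD : D.IsDAG) (h : D.MarkedEdge i a k b) : b = !a := by
  cases a <;> cases b
  exacts [(hD.no_full _ _ h).elim, rfl, rfl, (hD.no_dashed _ _ h).elim]

/-- Two successive collisions would need a dashed line between them. -/
theorem fosterMatrix_of_walk (hD : D.IsDAG) (hi : i ∈ D.foster C) (hk : k ∈ D.foster C)
    (h : Walk D.MarkedEdge (D.condClosure C) ∅ i a k b) : D.fosterMatrix C i k := by
  refine ⟨hi, hk, ?_⟩
  cases h with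
  | edge he =>
    cases a <;> obtain rfl := hD.right_mark_eq_not he
    exacts [⟨k, .inr hk, .inr he, .inl rfl⟩, ⟨i, .inr hi, .inl rfl, .inr he⟩]
  | @step r _ b' c _ h hp he =>
    obtain ⟨rfl, rfl, hr⟩ : b' = true ∧ c = true ∧ r ∈ D.condClosure C := by
      simpa [Passes] using hp
    obtain rfl : b = false := hD.right_mark_eq_not he
    cases h with
    | edge he' =>
      obtain rfl : a = false := by simpa using hD.right_mark_eq_not he'
      exact ⟨r, hD.condClosure_eq C ▸ hr, .inr he', .inr he⟩
    | step _ hp' he' =>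
      have hb := hD.right_mark_eq_not he'
      simp_all [Passes]

theorem exists_walk_of_fosterMatrix (hD : D.IsDAG) (h : D.fosterMatrix C i k) :
    i = k ∨ ∃ a b, Walk D.MarkedEdge (D.condClosure C) T i a k b := by
  obtain ⟨-, -, r, hr, rfl | hri, rfl | hrk⟩ := h
  · exact .inl rfl
  · exact .inr ⟨true, false, .edge hrk⟩
  · exact .inr ⟨false, true, .edge hri⟩
  · have down : D.MarkedEdge i false r true := hri
    rw [← hD.condClosure_eq] at hr
    exact .inr ⟨false, false, (Walk.edge down).step (.inl ⟨rfl, rfl, hr⟩) hrk⟩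

theorem zer_fosterMatrix_iff (hD : D.IsDAG) (hCM : Disjoint C M) (hi : i ∈ D.foster C)
    (hk : k ∈ D.foster C) : zer (D.condClosure C ∩ M) (D.fosterMatrix C) i k ↔
      i = k ∨ ∃ a b, Walk D.MarkedEdge (D.condClosure C) M i a k b := by
  have hself {x} (hx : x ∈ D.foster C) : D.fosterMatrix C x x :=
    ⟨hx, hx, x, .inr hx, .inl rfl, .inl rfl⟩
  rw [zer_iff (hself hk)]
  constructor
  · have append {j l} (hj : j = i ∨ j ∈ D.condClosure C ∩ M ∧
        ∃ a b, Walk D.MarkedEdge (D.condClosure C) M i a j b) (h : D.fosterMatrix C j l) :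
        l = i ∨ ∃ a b, Walk D.MarkedEdge (D.condClosure C) M i a l b := by
      rcases hD.exists_walk_of_fosterMatrix (T := M) h with rfl | ⟨a', b', h'⟩
      · exact hj.imp_right (·.2)
      rcases hj with rfl | ⟨hj, a, b, hw⟩
      exacts [.inr ⟨a', b', h'⟩, .inr ⟨a, b', hw.trans (.of_mem hj.1 hj.2 _ _) h'⟩]
    rintro ⟨l, h, hlk⟩
    refine (append ?_ hlk).imp_left Eq.symm
    clear hlk
    induction h with
    | refl => exact .inl rfl
    | tail _ h ih => exact (append ih h.2).imp_right fun hw => ⟨h.1, hw⟩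
  · rintro (rfl | ⟨a, b, h⟩)
    · exact ⟨i, .refl, hself hi⟩
    have hR := isAncestral_condClosure hD.isSummaryGraph C
    have hRF := hD.foster_subset_condClosure C
    have pieces := (hR.walk_within hD.isSummaryGraph h (hRF hi) (hRF hk)).factor (D.condClosure C) ∅
    clear h
    induction pieces with
    | edge h => exact ⟨i, .refl, hD.fosterMatrix_of_walk hi hk h⟩
    | @step j k b b' c _ hp h ih =>
      have hj : j ∈ D.condClosure C ∩ M := by simpa using hp.mem_union
      obtain ⟨l, hl, hlj⟩ := ih (hD.mem_foster hCM hj)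
      exact ⟨j, hl.tail ⟨hj, hlj⟩, hD.fosterMatrix_of_walk (hD.mem_foster hCM hj) hk h⟩

theorem trek_cases (hD : D.IsDAG) (h : Walk D.MarkedEdge ∅ T i a k b) :
    (a = true ∧ b = false ∧ D.DirectedWalk T k i) ∨ (a = false ∧ b = true ∧ D.DirectedWalk T i k) ∨
      (a = true ∧ b = true ∧ ∃ t ∈ T, D.DirectedWalk T t i ∧ D.DirectedWalk T t k) := by
  induction h with
  | @edge k b he =>
    cases a <;> obtain rfl := hD.right_mark_eq_not he
    exacts [.inr (.inl ⟨rfl, rfl, .edge he⟩), .inl ⟨rfl, rfl, .edge he⟩]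
  | @step j k b b' c _ hp he ih =>
    obtain ⟨hb, hj⟩ : (b = false ∨ b' = false) ∧ j ∈ T := by simpa [Passes] using hp
    obtain rfl := hD.right_mark_eq_not he
    rcases ih with ⟨rfl, rfl, h⟩ | ⟨rfl, rfl, h⟩ | ⟨rfl, rfl, t, ht, h, h'⟩
    · cases b'
      · exact .inr (.inr ⟨rfl, rfl, j, hj, h, .edge he⟩)
      · exact .inl ⟨rfl, rfl, h.cons hj he⟩
    · obtain rfl : b' = false := by simpa using hb
      exact .inr (.inl ⟨rfl, rfl, h.step hj he⟩)
    · obtain rfl : b' = false := by simpa using hb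
      exact .inr (.inr ⟨rfl, rfl, t, ht, h, h'.step hj he⟩)

theorem directedWalk_of_trek_to_ancestral (hD : D.IsDAG) (hR : D.IsAncestral R) (hi : i ∉ R)
    (hk : k ∈ R) (h : Walk D.MarkedEdge ∅ (T \ R) i a k b) :
    b = false ∧ D.DirectedWalk (T \ R) k i := by
  rcases hD.trek_cases h with ⟨-, hb, h⟩ | ⟨-, -, h⟩ | ⟨-, -, t, ht, -, h⟩
  · exact ⟨hb, h⟩
  · exact absurd (hR.ancestor_mem h.isAncestor hk) hi
  · exact absurd (hR.ancestor_mem h.isAncestor hk) ht.2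

/-- A walk that starts outside of an ancestral set is split where it first meets the set. There it
arrives at the tail of an arrow, so this node is a transmitting node. -/
theorem trek_or_enters_ancestral (hD : D.IsDAG) (hR : D.IsAncestral R) (hi : i ∉ R)
    (h : Walk D.MarkedEdge R T i a k b) : Walk D.MarkedEdge ∅ (T \ R) i a k b ∨
      ∃ j ∈ R ∩ T, D.DirectedWalk (T \ R) j i ∧ ∃ a', Walk D.MarkedEdge R T j a' k b := by
  induction h with
  | edge he => exact .inl (.edge he)
  | @step j k b b' c _ hp he ih =>
    rcases ih with h | ⟨j', hj', hd, a', h⟩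
    · by_cases hj : j ∈ R
      · obtain ⟨rfl, hd⟩ := hD.directedWalk_of_trek_to_ancestral hR hi hj h
        have hjT : j ∈ T := by simpa [Passes] using hp
        exact .inr ⟨j, ⟨hj, hjT⟩, hd, b', .edge he⟩
      · have hp' : (b = false ∨ b' = false) ∧ j ∈ T := by simpa [Passes, hj] using hp
        exact .inl (h.step (.inr ⟨hp'.1, hp'.2, hj⟩) he)
    · exact .inr ⟨j', hj', hd, a', h.step hp he⟩

theorem walk_arrow_iff (hD : D.IsDAG) (hR : D.IsAncestral R) (hi : i ∉ R) (hk : k ∉ R) :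
    Walk D.MarkedEdge R T i true k false ↔ D.DirectedWalk (T \ R) k i := by
  have hG := hD.isSummaryGraph
  refine ⟨fun h => ?_, fun h => hG.walk_symm ((h.walk R).mono subset_rfl Set.sdiff_subset)⟩
  rcases hD.trek_or_enters_ancestral hR hi h with h | ⟨j, hj, -, a', h⟩
  · simpa using hD.trek_cases h
  · cases hR.head_of_mem hG (hG.walk_symm h) hk hj.1

theorem exists_walk_iff (hD : D.IsDAG) (hR : D.IsAncestral R) (hi : i ∉ R) (hk : k ∈ R) :
    (∃ a b, Walk D.MarkedEdge R T i a k b) ↔ D.DirectedWalk (T \ R) k i ∨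
      ∃ j ∈ R ∩ T, D.DirectedWalk (T \ R) j i ∧ ∃ a b, Walk D.MarkedEdge R T j a k b := by
  have up {j} (h : D.DirectedWalk (T \ R) j i) : Walk D.MarkedEdge R T i true j false :=
    hD.isSummaryGraph.walk_symm ((h.walk R).mono subset_rfl Set.sdiff_subset)
  constructor
  · rintro ⟨a, b, h⟩
    rcases hD.trek_or_enters_ancestral hR hi h with h | ⟨j, hj, hd, a', h⟩
    exacts [.inl (hD.directedWalk_of_trek_to_ancestral hR hi hk h).2, .inr ⟨j, hj, hd, a', b, h⟩]
  · rintro (h | ⟨j, hj, hd, a, b, h⟩)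
    exacts [⟨_, _, up h⟩, ⟨_, _, (up hd).trans (.of_mem hj.1 hj.2 _ _) h⟩]

theorem walk_dashed_iff (hD : D.IsDAG) (hR : D.IsAncestral R) (hi : i ∉ R) (hk : k ∉ R) :
    Walk D.MarkedEdge R T i true k true ↔
      (∃ t ∈ T \ R, D.DirectedWalk (T \ R) t i ∧ D.DirectedWalk (T \ R) t k) ∨
      ∃ j ∈ R ∩ T, ∃ l ∈ R ∩ T, D.DirectedWalk (T \ R) j i ∧
        (j = l ∨ ∃ a b, Walk D.MarkedEdge R T j a l b) ∧ D.DirectedWalk (T \ R) l k := by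
  have hG := hD.isSummaryGraph
  have down {x y} (h : D.DirectedWalk (T \ R) x y) : Walk D.MarkedEdge R T x false y true :=
    (h.walk R).mono subset_rfl Set.sdiff_subset
  constructor
  · intro h
    rcases hD.trek_or_enters_ancestral hR hi h with h | ⟨j, hj, hji, a, h⟩
    · exact .inl (by simpa using hD.trek_cases h)
    rcases hD.trek_or_enters_ancestral hR hk (hG.walk_symm h) with h | ⟨l, hl, hlk, b, h⟩
    · exact .inr ⟨j, hj, j, hj, hji, .inl rfl,
        (hD.directedWalk_of_trek_to_ancestral hR hk hj.1 h).2⟩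
    · exact .inr ⟨j, hj, l, hl, hji, .inr ⟨a, b, hG.walk_symm h⟩, hlk⟩
  · rintro (⟨t, ht, hti, htk⟩ | ⟨j, hj, l, hl, hji, rfl | ⟨a, b, h⟩, hlk⟩)
    · exact (hG.walk_symm (down hti)).trans (.inr ⟨.inl rfl, ht.1⟩) (down htk)
    · exact (hG.walk_symm (down hji)).trans (.of_mem hj.1 hj.2 _ _) (down hlk)
    · exact ((hG.walk_symm (down hji)).trans (.of_mem hj.1 hj.2 _ _) h).trans
        (.of_mem hl.1 hl.2 _ _) (down hlk)

theorem zer_arrow_iff_exists_walk (hD : D.IsDAG) (hCM : Disjoint C M)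
    (hi : i ∉ D.condClosure C) (hk : k ∈ D.foster C) :
    (zer (M \ D.condClosure C) D.edgeMatrix i k ∨ ∃ j ∈ D.condClosure C ∩ M,
      zer (M \ D.condClosure C) D.edgeMatrix i j ∧
        zer (D.condClosure C ∩ M) (D.fosterMatrix C) j k) ↔
      ∃ a b, Walk D.MarkedEdge (D.condClosure C) M i a k b := by
  have hkR := hD.foster_subset_condClosure C hk
  rw [hD.exists_walk_iff (isAncestral_condClosure hD.isSummaryGraph C) hi hkR,
    zer_edgeMatrix_iff, or_iff_right (ne_of_mem_of_not_mem hkR hi).symm]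
  constructor
  · rintro (h | ⟨j, hj, hij, hjk⟩)
    · exact .inl h
    replace hij := (zer_edgeMatrix_iff.1 hij).resolve_left (ne_of_mem_of_not_mem hj.1 hi).symm
    rcases (hD.zer_fosterMatrix_iff hCM (hD.mem_foster hCM hj) hk).1 hjk with rfl | hjk
    exacts [.inl hij, .inr ⟨j, hj, hij, hjk⟩]
  · exact Or.imp_right fun ⟨j, hj, hij, hjk⟩ => ⟨j, hj, zer_edgeMatrix_iff.2 (.inr hij),
      (hD.zer_fosterMatrix_iff hCM (hD.mem_foster hCM hj) hk).2 (.inr hjk)⟩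

theorem zer_dashed_iff_walk (hD : D.IsDAG) (hCM : Disjoint C M)
    (hi : i ∉ D.condClosure C) (hiM : i ∉ M) (hk : k ∉ D.condClosure C) (hkM : k ∉ M) :
    ((∃ j ∈ M \ D.condClosure C, zer (M \ D.condClosure C) D.edgeMatrix i j ∧
        zer (M \ D.condClosure C) D.edgeMatrix k j) ∨
      ∃ j ∈ D.condClosure C ∩ M, ∃ l ∈ D.condClosure C ∩ M,
        zer (M \ D.condClosure C) D.edgeMatrix i j ∧
          zer (D.condClosure C ∩ M) (D.fosterMatrix C) j l ∧
          zer (M \ D.condClosure C) D.edgeMatrix k l) ↔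
      Walk D.MarkedEdge (D.condClosure C) M i true k true := by
  have arrows {x} (hx : x ∉ M) {j} (hj : j ∈ M) : zer (M \ D.condClosure C) D.edgeMatrix x j ↔
      D.DirectedWalk (M \ D.condClosure C) j x := by
    rw [zer_edgeMatrix_iff, or_iff_right (ne_of_mem_of_not_mem hj hx).symm]
  rw [hD.walk_dashed_iff (isAncestral_condClosure hD.isSummaryGraph C) hi hk]
  refine or_congr (exists_congr fun j => and_congr_right fun hj => ?_)
    (exists_congr fun j => and_congr_right fun hj => exists_congr fun l =>
      and_congr_right fun hl => ?_)
  · rw [arrows hiM hj.1, arrows hkM hj.1]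
  · rw [arrows hiM hj.2, arrows hkM hl.2,
      hD.zer_fosterMatrix_iff hCM (hD.mem_foster hCM hj) (hD.mem_foster hCM hl)]

theorem outsiders_sdiff (hD : D.IsDAG) (C M : Set V) : D.outsiders C \ M = D.newU C M := by
  have hC := subset_condClosure (G := D) (S := C)
  rw [hD.outsiders_eq, newU_eq hD.isSummaryGraph]
  grind

theorem foster_sdiff (hD : D.IsDAG) (C M : Set V) : D.foster C \ M = D.newV C M := by
  rw [hD.foster_eq, newV_eq hD.isSummaryGraph, Set.sdiff_sdiff]

theorem outsiders_inter (hD : D.IsDAG) (hM : M ⊆ D.nodes) :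
    D.outsiders C ∩ M = M \ D.condClosure C := by
  rw [hD.outsiders_eq]
  grind

theorem summaryGraph_eq_reduce (hD : D.IsDAG) (hM : M ⊆ D.nodes) (hCM : Disjoint C M) :
    D.summaryGraph C M = D.reduce C M := by
  have hG := hD.isSummaryGraph
  have hR := isAncestral_condClosure hG C
  have hu := hD.outsiders_sdiff C M
  have hv := hD.foster_sdiff C M
  have hU {x} (hx : x ∈ D.newU C M) : x ∉ D.condClosure C ∧ x ∉ M :=
    ⟨(newU_eq hG C M ▸ hx).2, fun h => (newU_eq hG C M ▸ hx).1.2 (.inr h)⟩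
  have hV {x} (hx : x ∈ D.newV C M) : x ∈ D.foster C := (hv ▸ hx : x ∈ D.foster C \ M).1
  have hUV {x y} (hx : x ∈ D.newU C M) (hy : y ∈ D.newV C M) : x ≠ y :=
    (ne_of_mem_of_not_mem (newV_subset_condClosure hG C M hy) (hU hx).1).symm
  refine MixedGraph.ext hu hv (funext₂ fun i k => propext ?_) (funext₂ fun i k => propext ?_)
    (funext₂ fun i k => propext ?_) <;>
    simp only [summaryGraph, reduce, retype, coupled_walkGraph hG.isSymm, hu, hv,
      hD.outsiders_inter hM, hD.foster_inter hCM]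
  · refine or_congr (and_congr_right fun hi => and_congr_right fun hk =>
      and_congr_right fun hne => ?_) (and_congr_right fun hi => and_congr_right fun hk => ?_)
    · rw [hD.walk_arrow_iff hR (hU hi).1 (hU hk).1, zer_edgeMatrix_iff, or_iff_right hne]
    · rw [hD.zer_arrow_iff_exists_walk hCM (hU hi).1 (hV hk), and_iff_right (hUV hi hk)]
  · exact and_congr_right fun hi => and_congr_right fun hk => and_congr_right fun _ =>
      hD.zer_dashed_iff_walk hCM (hU hi).1 (hU hi).2 (hU hk).1 (hU hk).2
  · have no_full (hi : i ∈ D.newU C M) : ¬ (D.walkGraph (D.condClosure C) M).full i k :=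
      fun h => Bool.false_ne_true (hR.directedWalk hG h.2 (hU hi).1).1
    rw [or_iff_right fun h => no_full h.1 h.2.2]
    refine and_congr_right fun hi => and_congr_right fun hk => and_congr_right fun hne => ?_
    rw [hD.zer_fosterMatrix_iff hCM (hV hi) (hV hk), or_iff_right hne]

end IsDAG
end DAG

section Main

variable {G : MixedGraph V} {S T : Set V}

theorem isSummaryGraphAfter_reduce (hG : G.IsSummaryGraph) (hS : S ⊆ G.nodes) (hT : T ⊆ G.nodes)
    (hST : Disjoint S T) : G.IsSummaryGraphAfter S T (G.reduce S T) where
  isSummaryGraph := isSummaryGraph_reduce hG hS T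
  nodes_eq := nodes_reduce hG hS T
  v_eq := rfl
  preserves := preservesIndependence_reduce hG hS hT hST
  generated D C M hD hC hM hCM h := by
    have hD' := hD.isSummaryGraph
    rw [hD.summaryGraph_eq_reduce hM hCM] at h
    subst h
    have hS' := Set.subset_sdiff.1 (nodes_reduce hD' hC M ▸ hS)
    have hT' := Set.subset_sdiff.1 (nodes_reduce hD' hC M ▸ hT)
    have hMT : M ∪ T ⊆ D.nodes := Set.union_subset hM hT'.1
    have hdisj : Disjoint (C ∪ S) (M ∪ T) := by
      simp only [Set.disjoint_union_left, Set.disjoint_union_right] at hS' hT' ⊢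
      exact ⟨⟨hCM, hS'.2.2⟩, hT'.2.1.symm, hST⟩
    rw [reduce_reduce hD' hC hS hT hdisj, hD.summaryGraph_eq_reduce hMT hdisj]
    exact ⟨rfl, preservesIndependence_reduce hD' (Set.union_subset hC hS'.1) hMT hdisj⟩

end Main

end MixedGraph

open MixedGraph in
theorem proposition1_general {V : Type*} (G : MixedGraph V) (hG : G.IsSummaryGraph)
    (hfin : G.nodes.Finite) :
    (∀ S T : Set V, T.Subsingleton → S ⊆ G.nodes → T ⊆ G.nodes → Disjoint S T →
      ∃ G' : MixedGraph V, G.IsSummaryGraphAfter S T G' ∧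
        (∀ H, G.Generates S T H ↔ H = G') ∧
        (∀ H, G.GeneratesCondFirst S T H ↔ H = G') ∧
        (∀ H, (∃ K, G.Generates ∅ T K ∧ K.Generates S ∅ H) ↔ H = G') ∧
        (∀ H, (∃ K, G.Generates S ∅ K ∧ K.Generates ∅ T H) ↔ H = G')) ∧
    (∀ ops : List (Op V), (ops.map Op.node).Nodup → (∀ o ∈ ops, o.node ∈ G.nodes) →
      ∃ G' : MixedGraph V, G.IsSummaryGraphAfter (condSet ops) (margSet ops) G' ∧
        ∀ ops' : List (Op V), ops'.Perm ops → ∀ H, GeneratesList G ops' H ↔ H = G') := by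
  refine ⟨fun S T hT₁ hS hT hST => ⟨G.reduce S T, isSummaryGraphAfter_reduce hG hS hT hST,
    fun H => generates_iff hG hfin hS hT₁ hST, fun H => generatesCondFirst_iff hG hfin hS hT₁ hST,
    fun H => ?_, fun H => ?_⟩, fun ops hnd hops => ⟨G.reduce (condSet ops) (margSet ops),
      isSummaryGraphAfter_reduce hG (fun s => hops (.condition s)) (fun t => hops (.marginalise t))
        (disjoint_condSet_margSet hnd), fun ops' hperm H => ?_⟩⟩
  · have hS' : S ⊆ (G.reduce ∅ T).nodes := by
      rw [nodes_reduce hG (Set.empty_subset _), Set.empty_union]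
      exact Set.subset_sdiff.2 ⟨hS, hST⟩
    simpa using exists_generates_generates_iff (H := H) hG hfin (Set.empty_subset _) hT₁ hS'
      (Set.empty_subset _) Set.subsingleton_empty (by simpa using hST)
  · have hT' : T ⊆ (G.reduce S ∅).nodes := by
      rw [nodes_reduce hG hS, Set.union_empty]
      exact Set.subset_sdiff.2 ⟨hT, hST.symm⟩
    simpa using exists_generates_generates_iff (H := H) hG hfin hS Set.subsingleton_empty
      (Set.empty_subset _) hT' hT₁ (by simpa using hST)
  · have hc : condSet ops' = condSet ops := Set.ext fun _ => hperm.mem_iff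
    have hm : margSet ops' = margSet ops := Set.ext fun _ => hperm.mem_iff
    rw [generatesList_iff hG hfin ((hperm.map _).nodup_iff.2 hnd) fun o ho =>
      hops o (hperm.mem_iff.1 ho), hc, hm]

theorem proposition1 {V : Type*} [Finite V] (G : MixedGraph V) (hG : G.IsSummaryGraph) :
    -- the procedure for at most one conditioning node and at most one marginalising node
    (∀ S T : Set V, S.Subsingleton → T.Subsingleton → S ⊆ G.nodes → T ⊆ G.nodes → Disjoint S T →
      ∃ G' : MixedGraph V,
        G.IsSummaryGraphAfter S T G' ∧
        -- the procedure yields exactly this graph, whatever the order of the ancestors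
        (∀ H, G.Generates S T H ↔ H = G') ∧
        -- so does the procedure with the order within its first step reversed
        (∀ H, G.GeneratesCondFirst S T H ↔ H = G') ∧
        -- and so do the two successive single-node procedures, in either order
        (∀ H, (∃ K, G.Generates ∅ T K ∧ K.Generates S ∅ H) ↔ H = G') ∧
        (∀ H, (∃ K, G.Generates S ∅ K ∧ K.Generates ∅ T H) ↔ H = G')) ∧
    -- for larger sets, one node at a time in any order of the operations
    (∀ ops : List (MixedGraph.Op V), (ops.map MixedGraph.Op.node).Nodup →
      (∀ o ∈ ops, o.node ∈ G.nodes) →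
      ∃ G' : MixedGraph V,
        G.IsSummaryGraphAfter (MixedGraph.condSet ops) (MixedGraph.margSet ops) G' ∧
        ∀ ops' : List (MixedGraph.Op V), ops'.Perm ops →
          ∀ H, MixedGraph.GeneratesList G ops' H ↔ H = G') := by
  have h := proposition1_general G hG G.nodes.toFinite
  exact ⟨fun S T _ => h.1 S T, h.2⟩
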